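/- For integers $a,b,c,d,e,f,M$ let $$(a,b,c,d,e,f)(M)=\left|\{(x,y,z)\in\mathbb Z^3: M=ax^2+by^2+cz^2+dyz+ezx+fxy\}\right|.$$ Let $f(a,b)=\sum_{n=-\infty}^{\infty}a^{(n-1)n/2}b^{(n+1)n/2}$ for $|ab|<1$ be Ramanujan's theta function, and for $|q|<1$ put $\varphi(q)=f(q,q)=\sum_{n\in\mathbb Z}q^{n^2}$ and $\psi(q)=f(q,q^3)=\sum_{n\ge 0}q^{n(n+1)/2}$. For $0<q<1$ put $$m=\frac{\varphi(q)^2}{\varphi(q^3)^2},\qquad \alpha=\alpha(q)=1-\frac{\varphi(-q)^4}{\varphi(q)^4},\qquad \beta=\alpha(q^3).$$ Then the following hold. (1) For every integer $M\equiv 1,2\pmod 4$, $$\tfrac13(1,1,1,0,0,0)(M)=(1,6,6,0,0,0)(M)+2(2,3,6,0,0,0)(M).$$ (2) For every integer $M\equiv 1\pmod 8$, $$(1,8,8,0,0,0)(M)=\tfrac13(1,1,1,0,0,0)(M)=(1,6,6,0,0,0)(M)+2(2,3,6,0,0,0)(M).$$ (3) For every complex $q$ with $|q|<1$, $$\psi(q^2)\varphi(q)^2=\psi(q^2)\varphi(q^3)^2+4q\,\psi(q)\psi(q^3)\psi(q^6),$$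 $$\psi(q)\varphi(q)^2=\psi(q)\varphi(q^3)^2+4q\,\psi(q^3)\psi(q^6)\varphi(q),$$ $$\varphi(q)\psi(q^2)^2=\psi(q)\psi(q^3)\varphi(q^3)+q\,\varphi(q)\psi(q^6)^2.$$ (4) For every real $q$ with $0<q<1$ (and positive real roots), $$m-1=2\,\frac{\beta^{3/8}}{\alpha^{1/8}},\qquad m=\frac{\beta^{1/2}}{\alpha^{1/2}}+2\,\frac{\beta^{1/8}}{\alpha^{3/8}}.$$ (5) If $0<q<1$ and $p>0$ is a real number with $\alpha=\dfrac{p(2+p)^3}{(1+2p)^3}$, then $$\beta=\frac{p^3(2+p)}{1+2p},\qquad m=1+2p.$$ (6) All coefficients of the power series in $q$ of $\psi(q)\left(\varphi(q)^2-\varphi(q^3)^2\right)$ are non-negative. -/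

import Mathlib

/-- The representation number `(a,b,c,d,e,f)(M)`: the number of integer triples `(x, y, z)` with
`M = a x² + b y² + c z² + d y z + e z x + f x y`. -/
noncomputable def ternaryRepCount (a b c d e f M : ℤ) : ℕ :=
  Set.ncard {v : ℤ × ℤ × ℤ |
    M = a * v.1 ^ 2 + b * v.2.1 ^ 2 + c * v.2.2 ^ 2
      + d * v.2.1 * v.2.2 + e * v.2.2 * v.1 + f * v.1 * v.2.1}

/-- For positive definite diagonal forms the counted set is finite, so that the cardinality in
`ternaryRepCount` is the honest one. -/
theorem ternaryRep_finite {a b c : ℤ} (ha : 0 < a) (hb : 0 < b) (hc : 0 < c) (M : ℤ) :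
    {v : ℤ × ℤ × ℤ |
      M = a * v.1 ^ 2 + b * v.2.1 ^ 2 + c * v.2.2 ^ 2
        + 0 * v.2.1 * v.2.2 + 0 * v.2.2 * v.1 + 0 * v.1 * v.2.1}.Finite := by
  have key : ∀ k t : ℤ, 0 < k → k * t ^ 2 ≤ M → t ∈ Set.Icc (-M) M := by
    intro k t hk h
    have h1 : t ^ 2 ≤ k * t ^ 2 := by nlinarith [sq_nonneg t]
    have h2 : |t| ≤ t ^ 2 := by
      rw [← sq_abs]
      rcases (abs_nonneg t).eq_or_lt with h0 | h0
      · rw [← h0]; norm_num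
      · nlinarith
    exact Set.mem_Icc.2 (abs_le.1 (by linarith))
  refine ((Set.finite_Icc (-M) M).prod
    ((Set.finite_Icc (-M) M).prod (Set.finite_Icc (-M) M))).subset ?_
  rintro ⟨x, y, z⟩ h
  simp only [Set.mem_setOf_eq] at h
  have hx : 0 ≤ a * x ^ 2 := by positivity
  have hy : 0 ≤ b * y ^ 2 := by positivity
  have hz : 0 ≤ c * z ^ 2 := by positivity
  exact ⟨key a x ha (by linarith), key b y hb (by linarith), key c z hc (by linarith)⟩

/-- Ramanujan's general theta function
`f(a,b) = ∑_{n ∈ ℤ} a^{(n-1)n/2} b^{(n+1)n/2}` (for `|ab| < 1`). The exponents are non-negative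
integers, and the integer divisions by two are exact. -/
noncomputable def ramanujanTheta {𝕜 : Type*} [NormedField 𝕜] (a b : 𝕜) : 𝕜 :=
  ∑' n : ℤ, a ^ ((n - 1) * n / 2).toNat * b ^ ((n + 1) * n / 2).toNat

/-- `φ(q) = f(q,q)`. -/
noncomputable def ramanujanPhi {𝕜 : Type*} [NormedField 𝕜] (q : 𝕜) : 𝕜 :=
  ramanujanTheta q q

/-- `ψ(q) = f(q,q³)`. -/
noncomputable def ramanujanPsi {𝕜 : Type*} [NormedField 𝕜] (q : 𝕜) : 𝕜 :=
  ramanujanTheta q (q ^ 3)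

/-- The multiplier of degree `n`: `m(n,q) = φ(q)² / φ(qⁿ)²`. -/
noncomputable def ramanujanMultiplier (n : ℕ) (q : ℝ) : ℝ :=
  ramanujanPhi q ^ 2 / ramanujanPhi (q ^ n) ^ 2

/-- `α(q) = 1 - φ(-q)⁴ / φ(q)⁴`. -/
noncomputable def ramanujanAlpha (q : ℝ) : ℝ :=
  1 - ramanujanPhi (-q) ^ 4 / ramanujanPhi q ^ 4

/-- `β(n,q) = α(qⁿ)`. -/
noncomputable def ramanujanBeta (n : ℕ) (q : ℝ) : ℝ :=
  ramanujanAlpha (q ^ n)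

/-- `F ∈ P[q]`: on the unit disc, `F` is the sum of a power series whose coefficients are all
non-negative real numbers. -/
def IsPositiveQSeries (F : ℂ → ℂ) : Prop :=
  ∃ c : ℕ → ℝ, (∀ n, 0 ≤ c n) ∧
    ∀ q : ℂ, ‖q‖ < 1 → HasSum (fun n : ℕ => (c n : ℂ) * q ^ n) (F q)

/-!
Throughout, `φ = ramanujanPhi` and `ψ = ramanujanPsi`, and all theta series are first studied for
real `q ∈ (0, 1)`, where they are positive, so that divisions and extractions of square roots are
harmless; the identities then extend to the unit disc by the identity theorem.

Everything rests on the identity `ψ(q²) (φ(q)² - φ(q³)²) = 4 q ψ(q) ψ(q³) ψ(q⁶)`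
(`psi_comp_sq_mul_phi_sq_real`). Its proof uses Lambert series. With
`g(x, a) = ∑ xᵏ / (1 - a q^(2k))`, a comparison of Laurent coefficients shows that `g(x, a)` is a
quotient of two theta series in `x`, up to a factor independent of `x`
(`kroneckerSeries_mul_thetaSeries`), while expansion in geometric series shows
`g(x, a) = g(a, x)` (`kroneckerSeries_comm`). At `a = -1` this yields
`φ(q)² = 2 ∑ qⁿ / (1 + q^(2n))` (`two_mul_kroneckerSeries_eq_phi_sq`): the quotient of the two sides
is invariant under `q ↦ q²` and tends to `1` at `0`. In `φ(q)² - φ(q³)²` the terms with `3 ∣ n`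
cancel, and what remains is a value of `g` for the nome `q³`; its unknown factor is found from
another value, which is known because it is the odd part of a sum of two squares. Hence
`φ(q)² - φ(q³)²` is a quotient of theta series (`phi_sq_sub_phi_comp_cube_sq_mul`), and a product of
three theta series of nome `q³` (`exists_thetaSeries_triple_product`) turns it into the form above.

The relation `ψ(q)² = φ(q) ψ(q²)` gives the second identity. The third one needs in addition the
classical modular equation of degree three (`modular_equation_cleared`), which is a consequence of
Jacobi's quartic identity and of `φ(q) φ(q³) - φ(-q) φ(-q³) = 4 q ψ(q²) ψ(q⁶)`
(`ramanujanPhi_mul_sub_mul`), a fact about the norm form `x² + 3 y²`. In terms of the eighth roots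
of `α` and `β` the first and third identities are the two modular equations
(`exists_eighth_roots`), and these contain the parametrization, since `α` is strictly increasing
in `p`.

The product on the right of the second identity has non-negative coefficients, which is the
positivity statement. The statements on ternary forms are the first and third identities read
coefficientwise: each representation number is matched with the number of points in a fibre of the
exponent of a product of three theta series (`ncard_odd_even_even`, `ncard_odd_odd_even`).
-/

/-! ### Reindexing sums over lattices -/

theorem tsum_eq_add_of_bijective {α β γ 𝕜 : Type*} [NormedField 𝕜] [CompleteSpace 𝕜]
    {f : α → 𝕜} {e₁ : β → α} {e₂ : γ → α}
    (h : Function.Bijective (Sum.elim e₁ e₂)) (hf : Summable f) :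
    ∑' a, f a = ∑' b, f (e₁ b) + ∑' c, f (e₂ c) := by
  have h1 := ((Equiv.ofBijective _ h).tsum_eq f).symm
  rw [h1]
  have hs : Summable (fun x => f (Sum.elim e₁ e₂ x)) := hf.comp_injective h.injective
  exact Summable.tsum_sum (f := fun x => f (Sum.elim e₁ e₂ x))
    (hs.comp_injective Sum.inl_injective) (hs.comp_injective Sum.inr_injective)

theorem parity_bijective : Function.Bijective
    (Sum.elim (fun v : ℤ × ℤ => (v.1 + v.2, v.1 - v.2))
      (fun v : ℤ × ℤ => (v.1 + v.2 + 1, v.1 - v.2))) := by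
  constructor
  · rintro (⟨a, b⟩ | ⟨a, b⟩) (⟨c, d⟩ | ⟨c, d⟩) h <;> simp at h ⊢ <;> omega
  · rintro ⟨a, b⟩
    rcases Int.even_or_odd' (a + b) with ⟨k, hk | hk⟩
    · exact ⟨Sum.inl (k, a - k), by simp; omega⟩
    · exact ⟨Sum.inr (k, k - b), by simp; omega⟩

/-- A sum over `ℤ²` is split according to the parity of the sum of the two coordinates. -/
theorem tsum_parity_split {f : ℤ × ℤ → ℝ} (hf : Summable f) :
    ∑' v, f v = ∑' v : ℤ × ℤ, f (v.1 + v.2, v.1 - v.2)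
      + ∑' v : ℤ × ℤ, f (v.1 + v.2 + 1, v.1 - v.2) :=
  tsum_eq_add_of_bijective parity_bijective hf

theorem tsum_even_add_odd_int {𝕜 : Type*} [NormedField 𝕜] [CompleteSpace 𝕜] {f : ℤ → 𝕜}
    (hf : Summable f) :
    ∑' n, f n = ∑' n, f (2 * n) + ∑' n, f (2 * n + 1) := by
  refine tsum_eq_add_of_bijective (e₁ := fun n : ℤ => 2 * n) (e₂ := fun n : ℤ => 2 * n + 1) ?_ hf
  constructor
  · rintro (a | a) (c | c) h <;> simp at h ⊢ <;> omega
  · intro a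
    rcases Int.even_or_odd' a with ⟨k, hk | hk⟩
    · exact ⟨Sum.inl k, by simp; omega⟩
    · exact ⟨Sum.inr k, by simp; omega⟩

/-- A sum over `ℤ²` is organized by the sum `N` of the two coordinates. -/
theorem tsum_eq_add_shear {f : ℤ × ℤ → ℝ} (hf : Summable f) :
    ∑' v, f v = ∑' N : ℤ, ∑' n : ℤ, f (n, N - n) := by
  let e : ℤ × ℤ ≃ ℤ × ℤ :=
    { toFun := fun v => (v.2, v.1 - v.2)
      invFun := fun v => (v.1 + v.2, v.1)
      left_inv := fun v => by ext <;> simp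
      right_inv := fun v => by ext <;> simp }
  rw [← e.tsum_eq f]
  exact Summable.tsum_prod (f := fun v => f (e v)) (hf.comp_injective e.injective)

/-! ### The theta series -/

/-- The one-variable theta series `∑ q^(n²) xⁿ`, over `n ∈ ℤ`, for real `q` and `x`. The powers are
integer powers, so that the series is meaningful for `x ≠ 0` only. -/
noncomputable def thetaSeries (q x : ℝ) : ℝ := ∑' n : ℤ, q ^ (n ^ 2) * x ^ n

theorem summable_thetaSeries {q x : ℝ} (h0 : 0 < q) (h1 : q < 1) (hx : x ≠ 0) :
    Summable (fun n : ℤ => q ^ (n ^ 2) * x ^ n) := by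
  have key : ∀ y : ℝ, y ≠ 0 → Summable (fun n : ℕ => q ^ ((n : ℤ) ^ 2) * y ^ (n : ℤ)) := by
    intro y hy
    have hne : ∀ n : ℕ, q ^ ((n : ℤ) ^ 2) * y ^ (n : ℤ) ≠ 0 := fun n =>
      mul_ne_zero (zpow_ne_zero _ h0.ne') (zpow_ne_zero _ hy)
    refine summable_of_ratio_test_tendsto_lt_one (l := 0) one_pos
      (Filter.Eventually.of_forall hne) ?_
    have hlim : Filter.Tendsto (fun n : ℕ => q ^ n * (q ^ n * q * |y|)) Filter.atTop (nhds 0) := by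
      have h := tendsto_pow_atTop_nhds_zero_of_lt_one h0.le h1
      simpa using h.mul ((h.mul_const q).mul_const |y|)
    refine hlim.congr fun n => ?_
    have e1 : q ^ (((n + 1 : ℕ) : ℤ) ^ 2) = q ^ ((n : ℤ) ^ 2) * (q ^ n * q ^ n * q) := by
      rw [show (((n + 1 : ℕ) : ℤ) ^ 2) = (n : ℤ) ^ 2 + ((n : ℤ) + n + 1) by push_cast; ring,
        zpow_add₀ h0.ne', zpow_add₀ h0.ne', zpow_add₀ h0.ne']
      simp
    have e2 : y ^ (((n + 1 : ℕ) : ℤ)) = y ^ (n : ℤ) * y := by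
      push_cast
      rw [zpow_add₀ hy, zpow_one]
    rw [e1, e2, Real.norm_eq_abs, Real.norm_eq_abs, ← abs_div,
      show q ^ ((n : ℤ) ^ 2) * (q ^ n * q ^ n * q) * (y ^ (n : ℤ) * y)
          / (q ^ ((n : ℤ) ^ 2) * y ^ (n : ℤ)) = q ^ n * q ^ n * q * y by
        have := zpow_ne_zero ((n : ℤ) ^ 2) h0.ne'
        have := zpow_ne_zero (n : ℤ) hy
        field_simp,
      abs_mul, abs_of_pos (show 0 < q ^ n * q ^ n * q by positivity)]
    ring
  refine Summable.of_nat_of_neg (key x hx) ?_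
  refine (key x⁻¹ (inv_ne_zero hx)).congr fun n => ?_
  rw [inv_zpow, zpow_neg, neg_sq]

theorem summable_norm_thetaSeries {q x : ℝ} (h0 : 0 < q) (h1 : q < 1) (hx : x ≠ 0) :
    Summable (fun n : ℤ => ‖q ^ (n ^ 2) * x ^ n‖) :=
  (summable_thetaSeries h0 h1 hx).norm

theorem thetaSeries_pos {q x : ℝ} (h0 : 0 < q) (h1 : q < 1) (hx : 0 < x) :
    0 < thetaSeries q x :=
  (summable_thetaSeries h0 h1 hx.ne').tsum_pos (fun n => by positivity) 0 (by simp)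

theorem thetaSeries_inv (q x : ℝ) : thetaSeries q x⁻¹ = thetaSeries q x := by
  unfold thetaSeries
  rw [← (Equiv.neg ℤ).tsum_eq]
  refine tsum_congr fun n => ?_
  simp [zpow_neg]

/-- `x = -q` is a zero of the theta series: the terms `n` and `-1 - n` cancel. -/
theorem thetaSeries_neg_self {q : ℝ} (h0 : 0 < q) : thetaSeries q (-q) = 0 := by
  have h : thetaSeries q (-q) = -thetaSeries q (-q) := by
    unfold thetaSeries
    rw [← tsum_neg, ← (Equiv.subLeft (-1 : ℤ)).tsum_eq]
    refine tsum_congr fun n => ?_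
    have hq := h0.ne'
    simp only [Equiv.subLeft_apply]
    rw [show (-q) = (-1) * q by ring, mul_zpow, mul_zpow,
      show ((-1 : ℝ)) ^ (-1 - n) = - (-1) ^ n by
        rw [zpow_sub₀ (by norm_num), zpow_neg_one]
        rcases Int.even_or_odd n with h | h
        · simp [h.neg_one_zpow]
        · simp [h.neg_one_zpow]]
    have : q ^ ((-1 - n) ^ 2) * q ^ (-1 - n) = q ^ (n ^ 2) * q ^ n := by
      rw [← zpow_add₀ hq, ← zpow_add₀ hq]
      congr 1
      ring
    linear_combination (-(-1) ^ n) * this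
  linarith

theorem ramanujanPhi_eq_tsum {𝕜 : Type*} [NormedField 𝕜] (q : 𝕜) :
    ramanujanPhi q = ∑' n : ℤ, q ^ (n.natAbs ^ 2) := by
  unfold ramanujanPhi ramanujanTheta
  refine tsum_congr fun n => ?_
  rw [← pow_add]
  congr 1
  obtain ⟨k, hk⟩ : Even ((n - 1) * n) := by
    have := Int.even_mul_succ_self (n - 1); simpa using this
  have h2 : (n + 1) * n = 2 * (k + n) := by linarith
  have h3 : (n - 1) * n = 2 * k := by linarith
  have h4 : 0 ≤ k := by
    have : 0 ≤ (n - 1) * n := by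
      rcases le_or_gt n 0 with h | h
      · nlinarith
      · nlinarith
    omega
  have h5 : 0 ≤ k + n := by
    have : 0 ≤ (n + 1) * n := by
      rcases lt_or_ge n 0 with h | h
      · nlinarith
      · nlinarith
    omega
  rw [h2, h3, Int.mul_ediv_cancel_left _ two_ne_zero, Int.mul_ediv_cancel_left _ two_ne_zero]
  zify
  rw [Int.toNat_of_nonneg h4, Int.toNat_of_nonneg h5, sq_abs]
  linarith

theorem ramanujanPsi_eq_tsum {𝕜 : Type*} [NormedField 𝕜] (q : 𝕜) :
    ramanujanPsi q = ∑' n : ℤ, q ^ (2 * n ^ 2 + n).toNat := by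
  unfold ramanujanPsi ramanujanTheta
  refine tsum_congr fun n => ?_
  rw [← pow_mul, ← pow_add]
  congr 1
  obtain ⟨k, hk⟩ : Even ((n - 1) * n) := by
    have := Int.even_mul_succ_self (n - 1); simpa using this
  have h2 : (n + 1) * n = 2 * (k + n) := by linarith
  have h3 : (n - 1) * n = 2 * k := by linarith
  have h4 : 0 ≤ k := by
    have : 0 ≤ (n - 1) * n := by
      rcases le_or_gt n 0 with h | h
      · nlinarith
      · nlinarith
    omega
  have h5 : 0 ≤ k + n := by
    have : 0 ≤ (n + 1) * n := by
      rcases lt_or_ge n 0 with h | h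
      · nlinarith
      · nlinarith
    omega
  have h6 : 2 * n ^ 2 + n = k + 3 * (k + n) := by linarith
  rw [h2, h3, Int.mul_ediv_cancel_left _ two_ne_zero, Int.mul_ediv_cancel_left _ two_ne_zero]
  omega

theorem ramanujanPhi_eq_thetaSeries (q : ℝ) :
    ramanujanPhi q = thetaSeries q 1 := by
  rw [ramanujanPhi_eq_tsum, thetaSeries]
  refine tsum_congr fun n => ?_
  rw [one_zpow, mul_one, ← zpow_natCast]
  simp

theorem ramanujanPhi_neg_eq_thetaSeries (q : ℝ) :
    ramanujanPhi (-q) = thetaSeries q (-1) := by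
  rw [ramanujanPhi_eq_thetaSeries, thetaSeries, thetaSeries]
  refine tsum_congr fun n => ?_
  rw [one_zpow, mul_one, neg_eq_neg_one_mul, mul_zpow, mul_comm]
  congr 1
  rcases Int.even_or_odd n with h | h
  · rw [h.neg_one_zpow, (h.pow_of_ne_zero two_ne_zero).neg_one_zpow]
  · rw [h.neg_one_zpow, (h.pow).neg_one_zpow]

theorem two_mul_sq_add_self_nonneg (n : ℤ) : 0 ≤ 2 * n ^ 2 + n := by
  rcases lt_or_ge n 0 with h | h <;> nlinarith

theorem ramanujanPsi_eq_thetaSeries {q : ℝ} (h0 : 0 < q) :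
    ramanujanPsi q = thetaSeries (q ^ 2) q := by
  rw [ramanujanPsi_eq_tsum, thetaSeries]
  refine tsum_congr fun n => ?_
  rw [← zpow_natCast, Int.toNat_of_nonneg (two_mul_sq_add_self_nonneg n), ← zpow_natCast q 2,
    ← zpow_mul, ← zpow_add₀ h0.ne']
  rfl

theorem thetaSeries_self {q : ℝ} (h0 : 0 < q) (h1 : q < 1) :
    thetaSeries q q = 2 * ramanujanPsi (q ^ 2) := by
  have hq := h0.ne'
  rw [ramanujanPsi_eq_thetaSeries (by positivity), thetaSeries,
    tsum_even_add_odd_int (summable_thetaSeries h0 h1 hq), two_mul]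
  unfold thetaSeries
  congr 1
  · refine tsum_congr fun n => ?_
    simp only [← zpow_natCast, ← zpow_mul, ← zpow_add₀ hq]
    congr 1; push_cast; ring
  · rw [← (Equiv.subLeft (-1 : ℤ)).tsum_eq]
    refine tsum_congr fun n => ?_
    simp only [← zpow_natCast, ← zpow_mul, ← zpow_add₀ hq, Equiv.subLeft_apply]
    congr 1; push_cast; ring

theorem ramanujanPhi_pos {q : ℝ} (h0 : 0 < q) (h1 : q < 1) : 0 < ramanujanPhi q := by
  rw [ramanujanPhi_eq_thetaSeries]; exact thetaSeries_pos h0 h1 one_pos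

theorem ramanujanPsi_pos {q : ℝ} (h0 : 0 < q) (h1 : q < 1) : 0 < ramanujanPsi q := by
  rw [ramanujanPsi_eq_thetaSeries h0]
  exact thetaSeries_pos (by positivity) (pow_lt_one₀ h0.le h1 two_ne_zero) h0

theorem thetaSeries_mul {p q x y : ℝ} (h0 : 0 < q) (h1 : q < 1) (hx : x ≠ 0)
    (k0 : 0 < p) (k1 : p < 1) (hy : y ≠ 0) :
    thetaSeries q x * thetaSeries p y =
      ∑' v : ℤ × ℤ, (q ^ (v.1 ^ 2) * x ^ v.1) * (p ^ (v.2 ^ 2) * y ^ v.2) :=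
  tsum_mul_tsum_of_summable_norm (summable_norm_thetaSeries h0 h1 hx)
    (summable_norm_thetaSeries k0 k1 hy)

theorem summable_thetaSeries_mul {p q x y : ℝ} (h0 : 0 < q) (h1 : q < 1) (hx : x ≠ 0)
    (k0 : 0 < p) (k1 : p < 1) (hy : y ≠ 0) :
    Summable fun v : ℤ × ℤ => (q ^ (v.1 ^ 2) * x ^ v.1) * (p ^ (v.2 ^ 2) * y ^ v.2) :=
  summable_mul_of_summable_norm (summable_norm_thetaSeries h0 h1 hx)
    (summable_norm_thetaSeries k0 k1 hy)

/-! ### Quadratic relations between theta functions -/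

theorem ramanujanPhi_even_odd {q : ℝ} (h0 : 0 < q) (h1 : q < 1) :
    ramanujanPhi q = ramanujanPhi (q ^ 4) + 2 * q * ramanujanPsi (q ^ 8) ∧
      ramanujanPhi (-q) = ramanujanPhi (q ^ 4) - 2 * q * ramanujanPsi (q ^ 8) := by
  have hq := h0.ne'
  have k1 : q ^ 4 < 1 := pow_lt_one₀ h0.le h1 (by norm_num)
  have hE : ramanujanPhi (q ^ 4) = ∑' n : ℤ, q ^ ((2 * n) ^ 2) := by
    rw [ramanujanPhi_eq_thetaSeries, thetaSeries]
    refine tsum_congr fun n => ?_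
    rw [one_zpow, mul_one, ← zpow_natCast, ← zpow_mul]
    congr 1; push_cast; ring
  have hO : 2 * q * ramanujanPsi (q ^ 8) = ∑' n : ℤ, q ^ ((2 * n + 1) ^ 2) := by
    have := thetaSeries_self (q := q ^ 4) (by positivity) k1
    rw [show 2 * q * ramanujanPsi (q ^ 8) = q * (2 * ramanujanPsi ((q ^ 4) ^ 2)) by
      rw [← pow_mul]; ring, ← this, thetaSeries, ← tsum_mul_left]
    refine tsum_congr fun n => ?_
    nth_rewrite 1 [← zpow_one q]
    simp only [← zpow_natCast, ← zpow_mul, ← zpow_add₀ hq]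
    congr 1; push_cast; ring
  rw [hE, hO, ramanujanPhi_neg_eq_thetaSeries, ramanujanPhi_eq_thetaSeries]
  unfold thetaSeries
  rw [tsum_even_add_odd_int (summable_thetaSeries h0 h1 one_ne_zero),
    tsum_even_add_odd_int (summable_thetaSeries h0 h1 (neg_ne_zero.2 one_ne_zero))]
  constructor
  · simp
  · rw [sub_eq_add_neg, ← tsum_neg]
    congr 1
    · refine tsum_congr fun n => ?_
      simp [zpow_mul]
    · refine tsum_congr fun n => ?_
      rw [Odd.neg_one_zpow ⟨n, rfl⟩]; ring

theorem neg_one_zpow_mul_parity (s t : ℤ) :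
    ((-1 : ℝ)) ^ (s + t) * (-1) ^ (s - t) = 1 := by
  rw [← zpow_add₀ (by norm_num)]
  exact Even.neg_one_zpow ⟨s, by ring⟩

theorem neg_one_zpow_mul_parity' (s t : ℤ) :
    ((-1 : ℝ)) ^ (s + t + 1) * (-1) ^ (s - t) = -1 := by
  rw [← zpow_add₀ (by norm_num)]
  exact Odd.neg_one_zpow ⟨s, by ring⟩

/-- The product of two theta series splits according to the parity of the sum of the two summation
indices, and the signs at `x = -1` detect that parity. -/
theorem ramanujanPhi_mul_parity {p q : ℝ} (h0 : 0 < q) (h1 : q < 1) (k0 : 0 < p) (k1 : p < 1) :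
    ∃ E O : ℝ, E = (∑' v : ℤ × ℤ, q ^ ((v.1 + v.2) ^ 2) * p ^ ((v.1 - v.2) ^ 2)) ∧
      O = (∑' v : ℤ × ℤ, q ^ ((v.1 + v.2 + 1) ^ 2) * p ^ ((v.1 - v.2) ^ 2)) ∧
      ramanujanPhi q * ramanujanPhi p = E + O ∧
      ramanujanPhi (-q) * ramanujanPhi (-p) = E - O := by
  have hm : (-1 : ℝ) ≠ 0 := by norm_num
  refine ⟨_, _, rfl, rfl, ?_, ?_⟩
  · rw [ramanujanPhi_eq_thetaSeries, ramanujanPhi_eq_thetaSeries,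
      thetaSeries_mul h0 h1 one_ne_zero k0 k1 one_ne_zero,
      tsum_parity_split (summable_thetaSeries_mul h0 h1 one_ne_zero k0 k1 one_ne_zero)]
    simp
  · rw [ramanujanPhi_neg_eq_thetaSeries, ramanujanPhi_neg_eq_thetaSeries,
      thetaSeries_mul h0 h1 hm k0 k1 hm,
      tsum_parity_split (summable_thetaSeries_mul h0 h1 hm k0 k1 hm),
      sub_eq_add_neg, ← tsum_neg]
    congr 1
    · refine tsum_congr fun v => ?_
      linear_combination (q ^ ((v.1 + v.2) ^ 2) * p ^ ((v.1 - v.2) ^ 2)) *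
        neg_one_zpow_mul_parity v.1 v.2
    · refine tsum_congr fun v => ?_
      linear_combination (q ^ ((v.1 + v.2 + 1) ^ 2) * p ^ ((v.1 - v.2) ^ 2)) *
        neg_one_zpow_mul_parity' v.1 v.2

theorem ramanujanPhi_sq_add_sq {q : ℝ} (h0 : 0 < q) (h1 : q < 1) :
    ramanujanPhi q ^ 2 + ramanujanPhi (-q) ^ 2 = 2 * ramanujanPhi (q ^ 2) ^ 2 := by
  have hq := h0.ne'
  obtain ⟨E, O, hE, -, hp, hm⟩ := ramanujanPhi_mul_parity h0 h1 h0 h1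
  have k1 : q ^ 2 < 1 := pow_lt_one₀ h0.le h1 (by norm_num)
  have k0 : 0 < q ^ 2 := by positivity
  have : ramanujanPhi (q ^ 2) ^ 2 = E := by
    rw [hE, sq, ramanujanPhi_eq_thetaSeries, thetaSeries_mul k0 k1 one_ne_zero k0 k1 one_ne_zero]
    refine tsum_congr fun v => ?_
    simp only [one_zpow, mul_one, ← zpow_natCast, ← zpow_mul, ← zpow_add₀ hq]
    congr 1; push_cast; ring
  rw [this]
  linarith

theorem ramanujanPhi_mul_neg {q : ℝ} (h0 : 0 < q) (h1 : q < 1) :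
    ramanujanPhi q * ramanujanPhi (-q) = ramanujanPhi (-q ^ 2) ^ 2 := by
  have k1 : q ^ 2 < 1 := pow_lt_one₀ h0.le h1 (by norm_num)
  have e1 := ramanujanPhi_sq_add_sq h0 h1
  have e2 := ramanujanPhi_sq_add_sq (q := q ^ 2) (by positivity) k1
  obtain ⟨a, b⟩ := ramanujanPhi_even_odd h0 h1
  rw [← pow_mul] at e2
  norm_num at e2
  rw [a, b] at e1 ⊢
  linear_combination (-1 / 2) * e1 - e2

theorem ramanujanPsi_sq {q : ℝ} (h0 : 0 < q) (h1 : q < 1) :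
    ramanujanPsi q ^ 2 = ramanujanPhi q * ramanujanPsi (q ^ 2) := by
  have hq := h0.ne'
  have k2 : q ^ 2 < 1 := pow_lt_one₀ h0.le h1 (by norm_num)
  have k4 : q ^ 4 < 1 := pow_lt_one₀ h0.le h1 (by norm_num)
  have p2 : 0 < q ^ 2 := by positivity
  have p4 : 0 < q ^ 4 := by positivity
  have e8 : 2 * q * ramanujanPsi (q ^ 8) = q * thetaSeries (q ^ 4) (q ^ 4) := by
    rw [thetaSeries_self p4 k4, ← pow_mul]; ring
  rw [(ramanujanPhi_even_odd h0 h1).1, e8, ramanujanPhi_eq_thetaSeries,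
    ramanujanPsi_eq_thetaSeries h0, ramanujanPsi_eq_thetaSeries p2, ← pow_mul, add_mul, mul_assoc,
    sq, thetaSeries_mul p2 k2 hq p2 k2 hq,
    tsum_parity_split (summable_thetaSeries_mul p2 k2 hq p2 k2 hq)]
  norm_num only
  rw [thetaSeries_mul p4 k4 one_ne_zero p4 k4 p2.ne', thetaSeries_mul p4 k4 p4.ne' p4 k4 p2.ne',
    ← tsum_mul_left]
  congr 1
  · rw [← (Equiv.prodComm ℤ ℤ).tsum_eq]
    refine tsum_congr fun v => ?_
    simp only [one_zpow, mul_one, ← zpow_natCast, ← zpow_mul, ← zpow_add₀ hq, Equiv.prodComm_apply,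
      Prod.fst_swap, Prod.snd_swap]
    congr 1; push_cast; ring
  · rw [← ((Equiv.prodComm ℤ ℤ).trans
      (Equiv.prodCongr (Equiv.subLeft (-1 : ℤ)) (Equiv.refl ℤ))).tsum_eq]
    refine tsum_congr fun v => ?_
    nth_rewrite 5 [← zpow_one q]
    simp only [← zpow_natCast, ← zpow_mul, ← zpow_add₀ hq, Equiv.trans_apply, Equiv.prodComm_apply,
      Equiv.prodCongr_apply, Prod.map, Prod.fst_swap, Prod.snd_swap, Equiv.refl_apply,
      Equiv.subLeft_apply]
    congr 1; push_cast; ring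

theorem ramanujanPhi_sq_sub_sq {q : ℝ} (h0 : 0 < q) (h1 : q < 1) :
    ramanujanPhi q ^ 2 - ramanujanPhi (-q) ^ 2 = 8 * q * ramanujanPsi (q ^ 4) ^ 2 := by
  have k4 : q ^ 4 < 1 := pow_lt_one₀ h0.le h1 (by norm_num)
  obtain ⟨a, b⟩ := ramanujanPhi_even_odd h0 h1
  have c := ramanujanPsi_sq (q := q ^ 4) (by positivity) k4
  rw [← pow_mul] at c
  norm_num at c
  rw [a, b, c]
  ring

/-- Jacobi's quartic identity. -/
theorem ramanujanPhi_pow_four_sub {q : ℝ} (h0 : 0 < q) (h1 : q < 1) :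
    ramanujanPhi q ^ 4 - ramanujanPhi (-q) ^ 4 = 16 * q * ramanujanPsi (q ^ 2) ^ 4 := by
  have k2 : q ^ 2 < 1 := pow_lt_one₀ h0.le h1 (by norm_num)
  have a := ramanujanPhi_sq_sub_sq h0 h1
  have b := ramanujanPhi_sq_add_sq h0 h1
  have c := ramanujanPsi_sq (q := q ^ 2) (by positivity) k2
  rw [← pow_mul] at c
  norm_num at c
  calc _ = (ramanujanPhi q ^ 2 - ramanujanPhi (-q) ^ 2)
        * (ramanujanPhi q ^ 2 + ramanujanPhi (-q) ^ 2) := by ring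
    _ = 16 * q * (ramanujanPhi (q ^ 2) * ramanujanPsi (q ^ 4)) ^ 2 := by rw [a, b]; ring
    _ = _ := by rw [← c]; ring

/-- The degree-three relation between theta constants that comes from the norm form
`x² + 3 y²`: a pair of odd integers corresponds to an Eisenstein integer outside `ℤ[√-3]`, and
multiplication by a cube root of unity moves it into `ℤ[√-3]`. -/
theorem ramanujanPhi_mul_sub_mul {q : ℝ} (h0 : 0 < q) (h1 : q < 1) :
    ramanujanPhi q * ramanujanPhi (q ^ 3) - ramanujanPhi (-q) * ramanujanPhi (-q ^ 3) =
      4 * q * ramanujanPsi (q ^ 2) * ramanujanPsi (q ^ 6) := by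
  have hq := h0.ne'
  have k1 : q ^ 3 < 1 := pow_lt_one₀ h0.le h1 (by norm_num)
  have k0 : 0 < q ^ 3 := by positivity
  obtain ⟨E, O, -, hO, hp, hm⟩ := ramanujanPhi_mul_parity h0 h1 k0 k1
  have h6 : 4 * q * ramanujanPsi (q ^ 2) * ramanujanPsi (q ^ 6)
      = q * (thetaSeries q q * thetaSeries (q ^ 3) (q ^ 3)) := by
    rw [thetaSeries_self h0 h1, thetaSeries_self k0 k1, ← pow_mul]; ring
  rw [h6, hp, hm, thetaSeries_mul h0 h1 hq k0 k1 k0.ne',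
    tsum_parity_split (summable_thetaSeries_mul h0 h1 hq k0 k1 k0.ne')]
  -- the pairs with even sum are rotated into `ℤ[√-3]`
  have e1 : q * ∑' v : ℤ × ℤ, q ^ ((v.1 + v.2) ^ 2) * q ^ (v.1 + v.2) *
      ((q ^ 3) ^ ((v.1 - v.2) ^ 2) * (q ^ 3) ^ (v.1 - v.2)) = O := by
    let e : ℤ × ℤ ≃ ℤ × ℤ :=
      { toFun := fun v => (v.2, v.2 - v.1)
        invFun := fun v => (v.1 - v.2, v.1)
        left_inv := fun v => by ext <;> simp
        right_inv := fun v => by ext <;> simp }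
    rw [hO, ← e.tsum_eq, ← tsum_mul_left]
    refine tsum_congr fun v => ?_
    simp only [e, Equiv.coe_fn_mk]
    nth_rewrite 1 [← zpow_one q]
    simp only [← zpow_natCast, ← zpow_mul, ← zpow_add₀ hq]
    congr 1; push_cast; ring
  -- the other parity class gives the same sum, by the reflection `n ↦ -1 - n`
  have e2 : q * ∑' v : ℤ × ℤ, q ^ ((v.1 + v.2 + 1) ^ 2) * q ^ (v.1 + v.2 + 1) *
      ((q ^ 3) ^ ((v.1 - v.2) ^ 2) * (q ^ 3) ^ (v.1 - v.2)) = O := by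
    rw [← e1, ← ((Equiv.prodComm ℤ ℤ).trans
      (Equiv.prodCongr (Equiv.subLeft (-1 : ℤ)) (Equiv.subLeft (-1 : ℤ)))).tsum_eq]
    congr 1
    refine tsum_congr fun v => ?_
    simp only [← zpow_natCast, ← zpow_mul, ← zpow_add₀ hq, Equiv.trans_apply, Equiv.prodComm_apply,
      Equiv.prodCongr_apply, Prod.map, Prod.fst_swap, Prod.snd_swap, Equiv.subLeft_apply]
    congr 1; push_cast; ring
  rw [mul_add, e1, e2]
  ring

/-! ### The Lambert series of Kronecker -/

/-- `∑ xᵏ / (1 - a q^(2k))`, over `k ∈ ℤ`; it converges for `q² < |x| < 1`. -/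
noncomputable def kroneckerSeries (q x a : ℝ) : ℝ := ∑' k : ℤ, x ^ k / (1 - a * q ^ (2 * k))

open Filter Topology Asymptotics in
theorem summable_kroneckerSeries {q x a : ℝ} (h0 : 0 < q) (h1 : q < 1) (hx : q ^ 2 < |x|)
    (hx1 : |x| < 1) (ha : a ≠ 0) :
    Summable fun k : ℤ => x ^ k / (1 - a * q ^ (2 * k)) := by
  have hq := h0.ne'
  have hx0 : x ≠ 0 := by rintro rfl; simp at hx; nlinarith [sq_nonneg q]
  have hQ : Tendsto (fun n : ℕ => (q ^ 2) ^ n) atTop (𝓝 0) :=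
    tendsto_pow_atTop_nhds_zero_of_lt_one (by positivity) (pow_lt_one₀ h0.le h1 two_ne_zero)
  refine Summable.of_nat_of_neg ?_ ?_
  · refine summable_of_isBigO_nat (g := fun n : ℕ => x ^ n)
      (summable_geometric_of_abs_lt_one hx1) ?_
    have hlim : Tendsto (fun n : ℕ => (1 - a * (q ^ 2) ^ n)⁻¹) atTop (𝓝 (1 - a * 0)⁻¹) :=
      ((hQ.const_mul a).const_sub 1).inv₀ (by simp)
    have := (isBigO_refl (fun n : ℕ => x ^ n) atTop).mul (hlim.isBigO_one ℝ)
    refine this.congr (fun n => ?_) (fun n => by simp)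
    rw [div_eq_mul_inv, zpow_natCast, zpow_mul, zpow_natCast]
    norm_cast
  · refine summable_of_isBigO_nat (g := fun n : ℕ => (q ^ 2 / x) ^ n)
      (summable_geometric_of_abs_lt_one ?_) ?_
    · rw [abs_div, abs_of_pos (by positivity : 0 < q ^ 2), div_lt_one (by positivity)]
      exact hx
    have hlim : Tendsto (fun n : ℕ => ((q ^ 2) ^ n - a)⁻¹) atTop (𝓝 (0 - a)⁻¹) :=
      (hQ.sub_const a).inv₀ (by simpa using ha)
    have := (isBigO_refl (fun n : ℕ => (q ^ 2 / x) ^ n) atTop).mul (hlim.isBigO_one ℝ)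
    refine this.congr (fun n => ?_) (fun n => by simp)
    have e : q ^ (2 * (-(n : ℤ))) = ((q ^ 2) ^ n)⁻¹ := by
      rw [mul_neg, zpow_neg, zpow_mul, zpow_natCast]; norm_cast
    have hp : (q ^ 2) ^ n ≠ 0 := by positivity
    have hz : x ^ n ≠ 0 := pow_ne_zero _ hx0
    rw [e, zpow_neg, zpow_natCast, div_pow,
      show 1 - a * ((q ^ 2) ^ n)⁻¹ = ((q ^ 2) ^ n - a) * ((q ^ 2) ^ n)⁻¹ by
        rw [sub_mul, mul_inv_cancel₀ hp],
      div_eq_mul_inv, div_eq_mul_inv, mul_inv, inv_inv]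
    ring

/-- A sequence with `f (N + 1) = q^(2N+1) r f N` is a multiple of the coefficients
`q^(N²) r^N` of a theta series. -/
theorem eq_theta_coeff_of_recurrence {q r : ℝ} (hq : q ≠ 0) (hr : r ≠ 0) {f : ℤ → ℝ}
    (hf : ∀ N, f (N + 1) = q ^ (2 * N + 1) * r * f N) (N : ℤ) :
    f N = f 0 * (q ^ (N ^ 2) * r ^ N) := by
  have step : ∀ N : ℤ, q ^ ((N + 1) ^ 2) * r ^ (N + 1)
      = q ^ (2 * N + 1) * r * (q ^ (N ^ 2) * r ^ N) := by
    intro N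
    rw [show (N + 1) ^ 2 = (2 * N + 1) + N ^ 2 by ring, zpow_add₀ hq, zpow_add₀ hr, zpow_one]
    ring
  induction N using Int.induction_on with
  | zero => simp
  | succ n ih => rw [hf, ih, step]; ring
  | pred n ih =>
    have h := hf (-(n : ℤ) - 1)
    have s := step (-(n : ℤ) - 1)
    rw [sub_add_cancel] at h s
    have hc : q ^ (2 * (-(n : ℤ) - 1) + 1) * r ≠ 0 := mul_ne_zero (zpow_ne_zero _ hq) hr
    rw [h, s] at ih
    refine mul_left_cancel₀ hc ?_
    rw [ih]; ring

/-- The coefficient of `x^N` in the product of `kroneckerSeries q x a` and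
`thetaSeries q (-x / q)`. -/
noncomputable def kroneckerCoeff (q a : ℝ) (N : ℤ) : ℝ :=
  ∑' n : ℤ, q ^ (n ^ 2) * (-1 / q) ^ n / (1 - a * q ^ (2 * (N - n)))

theorem summable_kroneckerCoeff {q a : ℝ} (h0 : 0 < q) (h1 : q < 1) (ha : a ≠ 0) (N : ℤ) :
    Summable fun n : ℤ => q ^ (n ^ 2) * (-1 / q) ^ n / (1 - a * q ^ (2 * (N - n))) := by
  have hq := h0.ne'
  -- the terms are those of the product at `x = q`, on the line where the indices add up to `N`
  have hx : q ^ 2 < |q| := by rw [abs_of_pos h0]; nlinarith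
  have hx1 : |q| < 1 := by rwa [abs_of_pos h0]
  have hs := summable_mul_of_summable_norm
    (summable_norm_thetaSeries h0 h1 (by norm_num : (-1 : ℝ) ≠ 0))
    (summable_kroneckerSeries h0 h1 hx hx1 ha).norm
  have hi : Function.Injective (fun n : ℤ => (n, N - n)) := fun a b h => by simpa using h
  refine ((hs.comp_injective hi).mul_left (q ^ (-N))).congr fun n => ?_
  simp only [Function.comp_apply]
  rw [zpow_sub₀ hq, zpow_neg, div_zpow]
  have := zpow_ne_zero N hq
  have := zpow_ne_zero n hq
  field_simp

/-- In the combination `c (N + 1) + a q^(2N) c N` the denominators cancel, and the value of the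
theta series at its zero `x = -q` is left. -/
theorem kroneckerCoeff_add_one {q a : ℝ} (h0 : 0 < q) (h1 : q < 1) (ha : a ≠ 0)
    (hne : ∀ k : ℤ, a * q ^ (2 * k) ≠ 1) (N : ℤ) :
    kroneckerCoeff q a (N + 1) = q ^ (2 * N + 1) * (-a / q) * kroneckerCoeff q a N := by
  have hq := h0.ne'
  have hsum := summable_kroneckerCoeff h0 h1 ha N
  have e1 : kroneckerCoeff q a (N + 1) = ∑' n : ℤ,
      -(q ^ (2 * n)) * (q ^ (n ^ 2) * (-1 / q) ^ n / (1 - a * q ^ (2 * (N - n)))) := by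
    unfold kroneckerCoeff
    rw [← (Equiv.addRight (1 : ℤ)).tsum_eq]
    refine tsum_congr fun n => ?_
    simp only [Equiv.coe_addRight]
    rw [show N + 1 - (n + 1) = N - n by ring, show (n + 1) ^ 2 = 2 * n + n ^ 2 + 1 by ring,
      zpow_add₀ hq, zpow_add₀ hq, zpow_add₀ (by simpa using hq), zpow_one, zpow_one]
    field_simp
  have hs1 : Summable fun n : ℤ =>
      -(q ^ (2 * n)) * (q ^ (n ^ 2) * (-1 / q) ^ n / (1 - a * q ^ (2 * (N - n)))) := by
    refine ((Equiv.addRight (1 : ℤ)).summable_iff.2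
      (summable_kroneckerCoeff h0 h1 ha (N + 1))).congr fun n => ?_
    simp only [Function.comp_apply, Equiv.coe_addRight]
    rw [show N + 1 - (n + 1) = N - n by ring, show (n + 1) ^ 2 = 2 * n + n ^ 2 + 1 by ring,
      zpow_add₀ hq, zpow_add₀ hq, zpow_add₀ (by simpa using hq), zpow_one, zpow_one]
    field_simp
  have e2 : kroneckerCoeff q a (N + 1) + a * q ^ (2 * N) * kroneckerCoeff q a N = 0 := by
    rw [e1, kroneckerCoeff, ← tsum_mul_left, ← hs1.tsum_add (hsum.mul_left _), ← neg_zero,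
      ← thetaSeries_neg_self h0, thetaSeries, ← tsum_neg]
    refine tsum_congr fun n => ?_
    have hd : 1 - a * q ^ (2 * (N - n)) ≠ 0 := sub_ne_zero.2 (hne _).symm
    have e3 : q ^ (2 * N) = q ^ (2 * (N - n)) * q ^ (2 * n) := by
      rw [← zpow_add₀ hq]; congr 1; ring
    have e4 : (-q) ^ n = (-1 / q) ^ n * q ^ (2 * n) := by
      rw [zpow_mul, ← mul_zpow]; congr 1
      rw [show q ^ (2 : ℤ) = q ^ 2 by norm_cast]; field_simp
    rw [e3, e4]
    field_simp
    ring
  have e3 : q ^ (2 * N + 1) * (-a / q) = -(a * q ^ (2 * N)) := by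
    rw [zpow_add₀ hq, zpow_one]; field_simp
  rw [e3]
  linarith

/-- Kronecker's formula, up to the determination of the constant: as a function of `x`, the
product on the left has the quasi-periodicity of the theta series on the right. -/
theorem kroneckerSeries_mul_thetaSeries {q x a : ℝ} (h0 : 0 < q) (h1 : q < 1) (hx : q ^ 2 < |x|)
    (hx1 : |x| < 1) (ha : a ≠ 0) (hne : ∀ k : ℤ, a * q ^ (2 * k) ≠ 1) :
    kroneckerSeries q x a * thetaSeries q (-x / q) =
      kroneckerCoeff q a 0 * thetaSeries q (-a * x / q) := by
  have hq := h0.ne'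
  have hx0 : x ≠ 0 := by rintro rfl; simp at hx; nlinarith [sq_nonneg q]
  have hxq : -x / q ≠ 0 := div_ne_zero (neg_ne_zero.2 hx0) hq
  have s1 := summable_norm_thetaSeries h0 h1 hxq
  have s2 := (summable_kroneckerSeries h0 h1 hx hx1 ha).norm
  rw [mul_comm, thetaSeries, kroneckerSeries, tsum_mul_tsum_of_summable_norm s1 s2,
    tsum_eq_add_shear (summable_mul_of_summable_norm s1 s2), thetaSeries, ← tsum_mul_left]
  refine tsum_congr fun N => ?_
  have e : ∀ n : ℤ, q ^ (n ^ 2) * (-x / q) ^ n * (x ^ (N - n) / (1 - a * q ^ (2 * (N - n))))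
      = x ^ N * (q ^ (n ^ 2) * (-1 / q) ^ n / (1 - a * q ^ (2 * (N - n)))) := by
    intro n
    rw [zpow_sub₀ hx0, show -x / q = x * (-1 / q) by ring, mul_zpow]
    have := zpow_ne_zero n hx0
    field_simp
  simp only [e]
  rw [tsum_mul_left]
  change x ^ N * kroneckerCoeff q a N = _
  rw [eq_theta_coeff_of_recurrence hq (div_ne_zero (neg_ne_zero.2 ha) hq)
    (kroneckerCoeff_add_one h0 h1 ha hne) N, show -a * x / q = (-a / q) * x by ring, mul_zpow]
  ring

/-- Both sides are the double sum `∑ xᵏ aʲ Q^(k j)` over `k, j ≥ 0`. -/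
theorem tsum_pow_div_comm {Q x a : ℝ} (h0 : 0 < Q) (h1 : Q < 1) (hx : |x| < 1) (ha : |a| < 1) :
    ∑' k : ℕ, x ^ k / (1 - a * Q ^ k) = ∑' k : ℕ, a ^ k / (1 - x * Q ^ k) := by
  have key : ∀ x a : ℝ, |x| < 1 → |a| < 1 → ∑' k : ℕ, x ^ k / (1 - a * Q ^ k)
      = ∑' k : ℕ, ∑' j : ℕ, x ^ k * a ^ j * Q ^ (k * j) := by
    intro x a hx ha
    refine tsum_congr fun k => ?_
    have hk : |a * Q ^ k| < 1 := by
      rw [abs_mul, abs_of_pos (pow_pos h0 k)]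
      exact mul_lt_one_of_nonneg_of_lt_one_left (abs_nonneg a) ha (pow_le_one₀ h0.le h1.le)
    rw [div_eq_mul_inv, ← tsum_geometric_of_abs_lt_one hk, ← tsum_mul_left]
    refine tsum_congr fun j => ?_
    rw [mul_pow, pow_mul]; ring
  rw [key x a hx ha, key a x ha hx]
  have hs : Summable (Function.uncurry fun k j : ℕ => x ^ k * a ^ j * Q ^ (k * j)) := by
    have h := summable_mul_of_summable_norm (summable_geometric_of_abs_lt_one hx).norm
      (summable_geometric_of_abs_lt_one ha).norm
    refine Summable.of_norm_bounded h.norm fun v => ?_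
    obtain ⟨k, j⟩ := v
    simp only [Function.uncurry_apply_pair]
    rw [norm_mul]
    refine mul_le_of_le_one_right (norm_nonneg _) ?_
    rw [Real.norm_eq_abs, abs_of_pos (pow_pos h0 _)]
    exact pow_le_one₀ h0.le h1.le
  rw [← hs.tsum_comm]
  refine tsum_congr fun k => tsum_congr fun j => ?_
  rw [mul_comm j k]; ring

theorem tsum_int_eq_tsum_nat_add {f : ℤ → ℝ} (hf : Summable f) :
    ∑' k, f k = ∑' k : ℕ, f k + ∑' k : ℕ, f (-((k : ℤ) + 1)) := by
  have i1 : Function.Injective (fun n : ℕ => (n : ℤ)) := Nat.cast_injective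
  have i2 : Function.Injective (fun n : ℕ => (-((n : ℤ) + 1))) := fun a b h => by simpa using h
  exact tsum_of_nat_of_neg_add_one (hf.comp_injective i1) (hf.comp_injective i2)

/-- Kronecker's symmetry, seen by expanding the denominators in geometric series. -/
theorem kroneckerSeries_comm {q x a : ℝ} (h0 : 0 < q) (h1 : q < 1) (hx : q ^ 2 < |x|)
    (hx1 : |x| < 1) (ha : q ^ 2 < |a|) (ha1 : |a| < 1) :
    kroneckerSeries q x a = kroneckerSeries q a x := by
  have hq := h0.ne'
  have hQ0 : 0 < q ^ 2 := by positivity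
  have hQ1 : q ^ 2 < 1 := pow_lt_one₀ h0.le h1 two_ne_zero
  have key : ∀ x a : ℝ, q ^ 2 < |x| → |x| < 1 → q ^ 2 < |a| → |a| < 1 →
      kroneckerSeries q x a = ∑' k : ℕ, x ^ k / (1 - a * (q ^ 2) ^ k)
        - q ^ 2 / (x * a) * ∑' k : ℕ, (q ^ 2 / x) ^ k / (1 - (q ^ 2 / a) * (q ^ 2) ^ k) := by
    intro x a hx hx1 ha ha1
    have ha0 : a ≠ 0 := by rintro rfl; simp at ha; linarith
    have hx0 : x ≠ 0 := by rintro rfl; simp at hx; linarith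
    have hs := summable_kroneckerSeries h0 h1 hx hx1 ha0
    rw [kroneckerSeries, tsum_int_eq_tsum_nat_add hs, sub_eq_add_neg, ← tsum_mul_left,
      ← tsum_neg]
    congr 1
    · refine tsum_congr fun k => ?_
      rw [zpow_natCast, zpow_mul, zpow_natCast]; norm_cast
    · refine tsum_congr fun k => ?_
      have e1 : q ^ (2 * (-((k : ℤ) + 1))) = ((q ^ 2) ^ (k + 1))⁻¹ := by
        rw [mul_neg, zpow_neg, zpow_mul]; norm_cast
      have e2 : x ^ (-((k : ℤ) + 1)) = (x ^ (k + 1))⁻¹ := by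
        rw [zpow_neg]; norm_cast
      have hk : |q ^ 2 / a * (q ^ 2) ^ k| < 1 := by
        rw [abs_mul, abs_of_pos (pow_pos hQ0 k), abs_div, abs_of_pos hQ0]
        refine mul_lt_one_of_nonneg_of_lt_one_left (by positivity) ?_ (pow_le_one₀ hQ0.le hQ1.le)
        rw [div_lt_one (by positivity)]; exact ha
      have hd : 1 - q ^ 2 / a * (q ^ 2) ^ k ≠ 0 := by
        have := (abs_lt.1 hk).2; linarith
      have hp : (q ^ 2) ^ k ≠ 0 := by positivity
      have hz : x ^ k ≠ 0 := pow_ne_zero _ hx0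
      have hd2 : a - (q ^ 2) ^ k * q ^ 2 ≠ 0 := by
        intro h
        apply hd
        field_simp
        linarith
      rw [e1, e2, pow_succ, pow_succ, div_pow,
        show 1 - q ^ 2 / a * (q ^ 2) ^ k = (a - (q ^ 2) ^ k * q ^ 2) / a by field_simp,
        show 1 - a * ((q ^ 2) ^ k * q ^ 2)⁻¹ = -(a - (q ^ 2) ^ k * q ^ 2) / ((q ^ 2) ^ k * q ^ 2) by
          field_simp; ring]
      field_simp
  have hbd : ∀ y : ℝ, q ^ 2 < |y| → |q ^ 2 / y| < 1 := by
    intro y hy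
    rw [abs_div, abs_of_pos hQ0, div_lt_one (by linarith)]; exact hy
  rw [key x a hx hx1 ha ha1, key a x ha ha1 hx hx1, tsum_pow_div_comm hQ0 hQ1 hx1 ha1,
    tsum_pow_div_comm hQ0 hQ1 (hbd x hx) (hbd a ha), mul_comm x a]

/-! ### Generating functions of exponent maps -/

/-- An exponent map `E : ι → ℕ` is summable if `∑ r^(E v)` converges for `0 ≤ r < 1`. -/
def IsSummableExponent {ι : Type*} (E : ι → ℕ) : Prop :=
  ∀ r : ℝ, 0 ≤ r → r < 1 → Summable fun v => r ^ E v

theorem isSummableExponent_of_natAbs_le {E : ℤ → ℕ} (h : ∀ n, n.natAbs ≤ E n + 1) :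
    IsSummableExponent E := by
  intro r h0 h1
  -- a positive base `s` absorbs the shift by one in the hypothesis, also when `r = 0`
  obtain ⟨s, hrs, hs0, hs1⟩ : ∃ s : ℝ, r ≤ s ∧ 0 < s ∧ s < 1 :=
    ⟨max r (1 / 2), le_max_left _ _, by positivity, max_lt h1 (by norm_num)⟩
  have hs : Summable fun n : ℤ => s ^ n.natAbs := by
    refine Summable.of_nat_of_neg ?_ ?_ <;>
      simpa using summable_geometric_of_lt_one hs0.le hs1
  refine (hs.mul_right s⁻¹).of_nonneg_of_le (fun n => pow_nonneg h0 _) fun n => ?_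
  rw [← div_eq_mul_inv, le_div_iff₀ hs0]
  calc r ^ E n * s ≤ s ^ E n * s := by gcongr
    _ = s ^ (E n + 1) := (pow_succ _ _).symm
    _ ≤ s ^ n.natAbs := pow_le_pow_of_le_one hs0.le hs1.le (h n)

theorem isSummableExponent_sq : IsSummableExponent fun n : ℤ => n.natAbs ^ 2 :=
  isSummableExponent_of_natAbs_le fun _ => (Nat.le_self_pow two_ne_zero _).trans (Nat.le_succ _)

theorem isSummableExponent_two_mul_sq_add : IsSummableExponent fun n : ℤ => (2 * n ^ 2 + n).toNat :=
  isSummableExponent_of_natAbs_le fun n => by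
    have : (n.natAbs : ℤ) ≤ 2 * n ^ 2 + n := by
      rw [Int.natCast_natAbs]
      rcases abs_cases n with ⟨h, h'⟩ | ⟨h, h'⟩ <;> rw [h] <;> nlinarith
    omega

theorem IsSummableExponent.summable_norm {ι 𝕜 : Type*} [NormedField 𝕜] {E : ι → ℕ}
    (h : IsSummableExponent E) {q : 𝕜} (hq : ‖q‖ < 1) : Summable fun v => ‖q ^ E v‖ := by
  simpa using h ‖q‖ (norm_nonneg q) hq

theorem IsSummableExponent.continuousAt {ι 𝕜 : Type*} [NormedField 𝕜] [CompleteSpace 𝕜]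
    {E : ι → ℕ} (h : IsSummableExponent E) {q : 𝕜} (hq : ‖q‖ < 1) :
    ContinuousAt (fun q : 𝕜 => ∑' v, q ^ E v) q := by
  obtain ⟨r, hr, hr1⟩ := exists_between hq
  have hc : ContinuousOn (fun q : 𝕜 => ∑' v, q ^ E v) (Metric.ball 0 r) := by
    refine continuousOn_tsum (u := fun v => r ^ E v) (fun v => by fun_prop)
      (h r ((norm_nonneg q).trans hr.le) hr1) fun v x hx => ?_
    rw [norm_pow]
    exact pow_le_pow_left₀ (norm_nonneg x) (mem_ball_zero_iff.1 hx).le _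
  exact hc.continuousAt (Metric.isOpen_ball.mem_nhds (mem_ball_zero_iff.2 hr))

theorem continuousAt_ramanujanPhi {𝕜 : Type*} [NormedField 𝕜] [CompleteSpace 𝕜] {q : 𝕜}
    (hq : ‖q‖ < 1) : ContinuousAt (ramanujanPhi : 𝕜 → 𝕜) q := by
  rw [funext ramanujanPhi_eq_tsum]
  exact isSummableExponent_sq.continuousAt hq

theorem continuousAt_ramanujanPsi {𝕜 : Type*} [NormedField 𝕜] [CompleteSpace 𝕜] {q : 𝕜}
    (hq : ‖q‖ < 1) : ContinuousAt (ramanujanPsi : 𝕜 → 𝕜) q := by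
  rw [funext ramanujanPsi_eq_tsum]
  exact isSummableExponent_two_mul_sq_add.continuousAt hq

theorem ramanujanPhi_zero {𝕜 : Type*} [NormedField 𝕜] : ramanujanPhi (0 : 𝕜) = 1 := by
  rw [ramanujanPhi_eq_tsum, tsum_eq_single 0]
  · simp
  · intro n hn
    exact zero_pow (by positivity)

theorem ramanujanPsi_zero {𝕜 : Type*} [NormedField 𝕜] : ramanujanPsi (0 : 𝕜) = 1 := by
  rw [ramanujanPsi_eq_tsum, tsum_eq_single 0]
  · simp
  · intro n hn
    refine zero_pow ?_
    have : 0 < 2 * n ^ 2 + n := by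
      rcases lt_or_gt_of_ne hn with h | h <;> nlinarith
    omega

/-! ### Sums of two squares as a Lambert series -/

open Filter Topology in
/-- A function of `q ∈ (0, 1)` that is invariant under `q ↦ q²` equals its limit at `0`. -/
theorem eq_of_comp_sq_eq {f : ℝ → ℝ} {l : ℝ} (hf : ∀ q, 0 < q → q < 1 → f (q ^ 2) = f q)
    (hl : Tendsto f (𝓝[>] 0) (𝓝 l)) {q : ℝ} (h0 : 0 < q) (h1 : q < 1) : f q = l := by
  have hn : ∀ n : ℕ, f (q ^ 2 ^ n) = f q := by
    intro n
    induction n with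
    | zero => simp
    | succ n ih =>
      rw [pow_succ, pow_mul, hf _ (by positivity) (pow_lt_one₀ h0.le h1 (by positivity)), ih]
  have hq : Tendsto (fun n : ℕ => q ^ 2 ^ n) atTop (𝓝[>] 0) := by
    refine tendsto_nhdsWithin_iff.2 ⟨?_, Eventually.of_forall fun n => by
      simp only [Set.mem_Ioi]; positivity⟩
    exact (tendsto_pow_atTop_nhds_zero_of_lt_one h0.le h1).comp
      (tendsto_pow_atTop_atTop_of_one_lt (by norm_num))
  have h := hl.comp hq
  simp only [Function.comp_def, hn] at h
  exact tendsto_nhds_unique tendsto_const_nhds h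

open Filter Topology in
theorem tendsto_ramanujanPhi : Tendsto (ramanujanPhi : ℝ → ℝ) (𝓝[>] 0) (𝓝 1) := by
  have h : ContinuousAt (ramanujanPhi : ℝ → ℝ) 0 := continuousAt_ramanujanPhi (by simp)
  rw [ContinuousAt, ramanujanPhi_zero] at h
  exact h.mono_left nhdsWithin_le_nhds

open Filter Topology in
theorem ramanujanPhi_neg_pos {q : ℝ} (h0 : 0 < q) (h1 : q < 1) : 0 < ramanujanPhi (-q) := by
  have hne : ramanujanPhi (-q) ≠ 0 := by
    classical
    -- the vanishing of `φ(-q)` is a property invariant under `q ↦ q²`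
    have hinv := eq_of_comp_sq_eq (f := fun q => if ramanujanPhi (-q) = 0 then 0 else 1)
      (l := 1) (fun q h0 h1 => ?_) ?_ h0 h1
    · intro h
      simp [h] at hinv
    · have h := ramanujanPhi_mul_neg h0 h1
      have hp := (ramanujanPhi_pos h0 h1).ne'
      have : ramanujanPhi (-q ^ 2) = 0 ↔ ramanujanPhi (-q) = 0 := by
        constructor
        · intro h'
          rw [h'] at h
          simpa [hp] using h
        · intro h'
          rw [h'] at h
          simpa using h.symm
      simp only [this]
    · have h : ContinuousAt (fun q : ℝ => ramanujanPhi (-q)) 0 := by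
        refine ContinuousAt.comp (g := (ramanujanPhi : ℝ → ℝ)) ?_ continuousAt_neg
        exact continuousAt_ramanujanPhi (by simp)
      have h2 : ∀ᶠ q : ℝ in 𝓝[>] 0, ramanujanPhi (-q) ≠ 0 :=
        (h.eventually_ne (by simp [ramanujanPhi_zero])).filter_mono nhdsWithin_le_nhds
      refine tendsto_const_nhds.congr' ?_
      filter_upwards [h2] with q hq
      simp [hq]
  refine lt_of_le_of_ne ?_ hne.symm
  have h := ramanujanPhi_mul_neg h0 h1
  have hp := ramanujanPhi_pos h0 h1
  by_contra hlt
  nlinarith [sq_nonneg (ramanujanPhi (-q ^ 2))]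

theorem neg_one_mul_zpow_ne_one {q : ℝ} (h0 : 0 < q) (k : ℤ) : -1 * q ^ (2 * k) ≠ 1 := by
  have : 0 < q ^ (2 * k) := by positivity
  linarith

theorem kroneckerSeries_neg_one_bounds {q : ℝ} (h0 : 0 < q) (h1 : q < 1) :
    1 ≤ 2 * kroneckerSeries q q (-1) ∧ 2 * kroneckerSeries q q (-1) ≤ 1 + 4 * (q / (1 - q)) := by
  have hq := h0.ne'
  have hs := summable_kroneckerSeries h0 h1 (x := q) (a := -1) (by rw [abs_of_pos h0]; nlinarith)
    (by rwa [abs_of_pos h0]) (by norm_num)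
  have hg : Summable fun k : ℕ => q ^ (k + 1) :=
    (summable_nat_add_iff 1).2 (summable_geometric_of_lt_one h0.le h1)
  have hsum : ∑' k : ℕ, q ^ (k + 1) = q / (1 - q) := by
    simp_rw [pow_succ]
    rw [tsum_mul_right, tsum_geometric_of_lt_one h0.le h1]
    field_simp
  have hb : ∀ k : ℕ, q ^ (k + 1) / (1 + q ^ (2 * (k + 1))) ≤ q ^ (k + 1) := fun k =>
    div_le_self (by positivity) (by linarith [pow_pos h0 (2 * (k + 1))])
  have hp : ∀ k : ℕ, 0 ≤ q ^ (k + 1) / (1 + q ^ (2 * (k + 1))) := fun k => by positivity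
  have hs' : Summable fun k : ℕ => q ^ (k + 1) / (1 + q ^ (2 * (k + 1))) :=
    hg.of_nonneg_of_le hp hb
  have e : kroneckerSeries q q (-1)
      = 1 / 2 + 2 * ∑' k : ℕ, q ^ (k + 1) / (1 + q ^ (2 * (k + 1))) := by
    have i1 : Function.Injective (fun n : ℕ => (n : ℤ)) := Nat.cast_injective
    have hS : ∀ S : ℝ, 1 / 2 + 2 * S = 1 / 2 + S + S := fun S => by ring
    rw [kroneckerSeries, tsum_int_eq_tsum_nat_add hs,
      Summable.tsum_eq_zero_add (f := fun k : ℕ => q ^ (k : ℤ) / (1 - -1 * q ^ (2 * (k : ℤ))))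
        (hs.comp_injective i1), hS]
    congr 1
    · congr 1
      · norm_num
      · refine tsum_congr fun k => ?_
        rw [show 2 * ((k + 1 : ℕ) : ℤ) = ((2 * (k + 1) : ℕ) : ℤ) by push_cast; ring,
          zpow_natCast, zpow_natCast, neg_one_mul, sub_neg_eq_add]
    · refine tsum_congr fun k => ?_
      have e2 : q ^ (-((k : ℤ) + 1)) = (q ^ (k + 1))⁻¹ := by rw [zpow_neg]; norm_cast
      have e3 : q ^ (2 * (-((k : ℤ) + 1))) = (q ^ (2 * (k + 1)))⁻¹ := by
        rw [mul_neg, zpow_neg]; norm_cast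
      rw [e2, e3, mul_comm 2 (k + 1), pow_mul]
      have hy : 0 < q ^ (k + 1) := by positivity
      generalize q ^ (k + 1) = y at hy
      rw [neg_one_mul, sub_neg_eq_add]
      field_simp
      ring
  rw [e]
  have h2 := hs'.tsum_le_tsum hb hg
  have h3 : 0 ≤ ∑' k : ℕ, q ^ (k + 1) / (1 + q ^ (2 * (k + 1))) := tsum_nonneg hp
  rw [hsum] at h2
  constructor <;> linarith

theorem kroneckerSeries_add_neg {q : ℝ} (h0 : 0 < q) (h1 : q < 1) :
    kroneckerSeries q q (-1) + kroneckerSeries q (-q) (-1)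
        = 2 * kroneckerSeries (q ^ 2) (q ^ 2) (-1) ∧
      kroneckerSeries q q (-1) - kroneckerSeries q (-q) (-1)
        = 2 * ∑' k : ℤ, q ^ (2 * k + 1) / (1 + q ^ (2 * (2 * k + 1))) := by
  have hq := h0.ne'
  have a1 : q ^ 2 < |q| := by rw [abs_of_pos h0]; nlinarith
  have a2 : |q| < 1 := by rwa [abs_of_pos h0]
  have s1 := summable_kroneckerSeries h0 h1 (x := q) (a := -1) a1 a2 (by norm_num)
  have s2 := summable_kroneckerSeries h0 h1 (x := -q) (a := -1) (by rwa [abs_neg])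
    (by rwa [abs_neg]) (by norm_num)
  have e1 : ∀ n : ℤ, (-q) ^ (2 * n) = q ^ (2 * n) := fun n => (even_two_mul n).neg_zpow q
  have e2 : ∀ n : ℤ, (-q) ^ (2 * n + 1) = -q ^ (2 * n + 1) := fun n => Odd.neg_zpow ⟨n, rfl⟩ q
  have e3 : ∑' n : ℤ, (-q) ^ (2 * n) / (1 - -1 * q ^ (2 * (2 * n)))
      = kroneckerSeries (q ^ 2) (q ^ 2) (-1) := by
    unfold kroneckerSeries
    refine tsum_congr fun n => ?_
    rw [e1]
    simp only [← zpow_natCast, ← zpow_mul]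
    congr 1
  have e4 : ∑' n : ℤ, (-q) ^ (2 * n + 1) / (1 - -1 * q ^ (2 * (2 * n + 1)))
      = - ∑' k : ℤ, q ^ (2 * k + 1) / (1 + q ^ (2 * (2 * k + 1))) := by
    rw [← tsum_neg]
    refine tsum_congr fun n => ?_
    rw [e2]
    ring
  have e5 : ∑' n : ℤ, q ^ (2 * n) / (1 - -1 * q ^ (2 * (2 * n)))
      = kroneckerSeries (q ^ 2) (q ^ 2) (-1) := by
    rw [← e3]; simp only [e1]
  have e6 : ∑' n : ℤ, q ^ (2 * n + 1) / (1 - -1 * q ^ (2 * (2 * n + 1)))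
      = ∑' k : ℤ, q ^ (2 * k + 1) / (1 + q ^ (2 * (2 * k + 1))) := by
    refine tsum_congr fun n => ?_
    ring
  have f1 : kroneckerSeries q q (-1) = _ := tsum_even_add_odd_int s1
  have f2 : kroneckerSeries q (-q) (-1) = _ := tsum_even_add_odd_int s2
  rw [f1, f2, e3, e4, e5, e6]
  constructor <;> ring

theorem kroneckerSeries_mul_phi {q : ℝ} (h0 : 0 < q) (h1 : q < 1) :
    kroneckerSeries q q (-1) * ramanujanPhi (-q) = kroneckerCoeff q (-1) 0 * ramanujanPhi q ∧
      kroneckerSeries q (-q) (-1) * ramanujanPhi q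
        = kroneckerCoeff q (-1) 0 * ramanujanPhi (-q) := by
  have hq := h0.ne'
  have a1 : q ^ 2 < |q| := by rw [abs_of_pos h0]; nlinarith
  have a2 : |q| < 1 := by rwa [abs_of_pos h0]
  have k1 := kroneckerSeries_mul_thetaSeries h0 h1 a1 a2 (by norm_num : (-1 : ℝ) ≠ 0)
    (neg_one_mul_zpow_ne_one h0)
  have k2 := kroneckerSeries_mul_thetaSeries (x := -q) h0 h1 (by rwa [abs_neg]) (by rwa [abs_neg])
    (by norm_num : (-1 : ℝ) ≠ 0) (neg_one_mul_zpow_ne_one h0)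
  have c1 : -q / q = -1 := by field_simp
  have c2 : - -1 * q / q = 1 := by field_simp
  have c3 : - -q / q = 1 := by field_simp
  have c4 : - -1 * -q / q = -1 := by field_simp
  rw [c1, c2, ← ramanujanPhi_neg_eq_thetaSeries, ← ramanujanPhi_eq_thetaSeries] at k1
  rw [c3, c4, ← ramanujanPhi_neg_eq_thetaSeries, ← ramanujanPhi_eq_thetaSeries] at k2
  exact ⟨k1, k2⟩

theorem kroneckerSeries_neg_mul_phi_sq {q : ℝ} (h0 : 0 < q) (h1 : q < 1) :
    kroneckerSeries q (-q) (-1) * ramanujanPhi q ^ 2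
      = kroneckerSeries q q (-1) * ramanujanPhi (-q) ^ 2 := by
  obtain ⟨k1, k2⟩ := kroneckerSeries_mul_phi h0 h1
  linear_combination ramanujanPhi q * k2 - ramanujanPhi (-q) * k1

open Filter Topology in
/-- Jacobi's two-square theorem in Lambert series form. By Kronecker's formula the quotient
of the two sides is the same at `q` and `-q`; comparing even parts, it is invariant under
`q ↦ q²`. -/
theorem two_mul_kroneckerSeries_eq_phi_sq {q : ℝ} (h0 : 0 < q) (h1 : q < 1) :
    2 * kroneckerSeries q q (-1) = ramanujanPhi q ^ 2 := by
  have hinv := eq_of_comp_sq_eq (f := fun q => 2 * kroneckerSeries q q (-1) / ramanujanPhi q ^ 2)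
    (l := 1) (fun q h0 h1 => ?_) ?_ h0 h1
  · have := (ramanujanPhi_pos h0 h1).ne'
    field_simp at hinv
    linarith
  · have hp := ramanujanPhi_pos h0 h1
    have hp2 := ramanujanPhi_pos (q := q ^ 2) (by positivity) (pow_lt_one₀ h0.le h1 two_ne_zero)
    have e := (kroneckerSeries_add_neg h0 h1).1
    have s := ramanujanPhi_sq_add_sq h0 h1
    rw [div_eq_div_iff (by positivity) (by positivity)]
    linear_combination (-ramanujanPhi q ^ 2) * e + kroneckerSeries_neg_mul_phi_sq h0 h1
      + kroneckerSeries q q (-1) * s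
  · have hL : Tendsto (fun q : ℝ => 2 * kroneckerSeries q q (-1)) (𝓝[>] 0) (𝓝 1) := by
      have hc : ContinuousAt (fun q : ℝ => 1 + 4 * (q / (1 - q))) 0 := by
        refine ContinuousAt.add continuousAt_const (ContinuousAt.mul continuousAt_const
          (ContinuousAt.div continuousAt_id (by fun_prop) (by norm_num)))
      have hu : Tendsto (fun q : ℝ => 1 + 4 * (q / (1 - q))) (𝓝[>] 0) (𝓝 1) := by
        have := hc.tendsto.mono_left (nhdsWithin_le_nhds (s := Set.Ioi 0))
        simpa using this
      have hev : ∀ᶠ q : ℝ in 𝓝[>] 0, 0 < q ∧ q < 1 := Ioo_mem_nhdsGT one_pos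
      refine tendsto_of_tendsto_of_tendsto_of_le_of_le' tendsto_const_nhds hu ?_ ?_
      · filter_upwards [hev] with q hq using (kroneckerSeries_neg_one_bounds hq.1 hq.2).1
      · filter_upwards [hev] with q hq using (kroneckerSeries_neg_one_bounds hq.1 hq.2).2
    have h := hL.div (tendsto_ramanujanPhi.pow 2) (by norm_num)
    rwa [one_pow, div_one] at h

/-- The odd part of the Lambert series for `φ(t)²`. -/
theorem tsum_odd_lambert {t : ℝ} (h0 : 0 < t) (h1 : t < 1) :
    ∑' k : ℤ, t ^ (2 * k + 1) / (1 + t ^ (2 * (2 * k + 1))) = 2 * t * ramanujanPsi (t ^ 4) ^ 2 := by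
  have e := (kroneckerSeries_add_neg h0 h1).2
  have a := two_mul_kroneckerSeries_eq_phi_sq h0 h1
  have b := kroneckerSeries_neg_mul_phi_sq h0 h1
  have hp := ramanujanPhi_pos h0 h1
  have c : 2 * kroneckerSeries t (-t) (-1) = ramanujanPhi (-t) ^ 2 := by
    refine mul_right_cancel₀ (pow_ne_zero 2 hp.ne') ?_
    linear_combination 2 * b + ramanujanPhi (-t) ^ 2 * a
  linear_combination (-1 / 2) * e + (1 / 4) * a - (1 / 4) * c
    + (1 / 4) * ramanujanPhi_sq_sub_sq h0 h1

/-! ### The difference `φ(q)² - φ(q³)²` -/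

theorem tsum_mod_three_split {f : ℤ → ℝ} (hf : Summable f) :
    ∑' n, f n = ∑' k, f (3 * k) + (∑' k, f (3 * k + 1) + ∑' k, f (-(3 * k + 1))) := by
  have h : Function.Bijective (Sum.elim (fun k : ℤ => 3 * k)
      (Sum.elim (fun k : ℤ => 3 * k + 1) (fun k : ℤ => -(3 * k + 1)))) := by
    constructor
    · rintro (a | a | a) (b | b | b) h <;> simp at h ⊢ <;> omega
    · intro n
      rcases (by omega : n % 3 = 0 ∨ n % 3 = 1 ∨ n % 3 = 2) with h | h | h
      · exact ⟨Sum.inl (n / 3), by simp; omega⟩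
      · exact ⟨Sum.inr (Sum.inl (n / 3)), by simp; omega⟩
      · exact ⟨Sum.inr (Sum.inr (-(n / 3) - 1)), by simp; omega⟩
  rw [tsum_eq_add_of_bijective h hf]
  congr 1
  have i : Function.Injective (Sum.elim (fun k : ℤ => 3 * k + 1) (fun k : ℤ => -(3 * k + 1))) :=
    h.injective.comp Sum.inr_injective
  have hs := hf.comp_injective i
  exact Summable.tsum_sum (hs.comp_injective Sum.inl_injective)
    (hs.comp_injective Sum.inr_injective)

/-- In the Lambert series for `φ(q)²` the terms with `3 ∣ n` form the series for `φ(q³)²`, and the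
classes of `1` and `-1` modulo `3` contribute equally, since the term is even in `n`. -/
theorem phi_sq_sub_phi_comp_cube_sq_eq_kroneckerSeries {q : ℝ} (h0 : 0 < q) (h1 : q < 1) :
    ramanujanPhi q ^ 2 - ramanujanPhi (q ^ 3) ^ 2
      = 4 * q * kroneckerSeries (q ^ 3) (q ^ 3) (-q ^ 2) := by
  have hq := h0.ne'
  have hs := summable_kroneckerSeries h0 h1 (x := q) (a := -1) (by rw [abs_of_pos h0]; nlinarith)
    (by rwa [abs_of_pos h0]) (by norm_num)
  rw [← two_mul_kroneckerSeries_eq_phi_sq h0 h1,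
    ← two_mul_kroneckerSeries_eq_phi_sq (q := q ^ 3) (by positivity)
      (pow_lt_one₀ h0.le h1 (by norm_num))]
  have f1 : kroneckerSeries q q (-1) = _ := tsum_mod_three_split hs
  have e1 : ∑' k : ℤ, q ^ (3 * k) / (1 - -1 * q ^ (2 * (3 * k)))
      = kroneckerSeries (q ^ 3) (q ^ 3) (-1) := by
    refine tsum_congr fun k => ?_
    simp only [← zpow_natCast, ← zpow_mul]
    rw [show 2 * (3 * k) = ((3 : ℕ) : ℤ) * (2 * k) by push_cast; ring]
    rfl
  have e2 : ∑' k : ℤ, q ^ (3 * k + 1) / (1 - -1 * q ^ (2 * (3 * k + 1)))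
      = q * kroneckerSeries (q ^ 3) (q ^ 3) (-q ^ 2) := by
    rw [kroneckerSeries, ← tsum_mul_left]
    refine tsum_congr fun k => ?_
    simp only [← zpow_natCast, ← zpow_mul]
    rw [show 2 * (3 * k + 1) = ((2 : ℕ) : ℤ) + ((3 : ℕ) : ℤ) * (2 * k) by push_cast; ring,
      zpow_add₀ hq, zpow_add₀ hq, zpow_one]
    push_cast
    ring
  have e3 : ∑' k : ℤ, q ^ (-(3 * k + 1)) / (1 - -1 * q ^ (2 * -(3 * k + 1)))
      = q * kroneckerSeries (q ^ 3) (q ^ 3) (-q ^ 2) := by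
    rw [← e2]
    refine tsum_congr fun k => ?_
    generalize 3 * k + 1 = m
    rw [mul_neg, zpow_neg, zpow_neg, two_mul, zpow_add₀ hq]
    have hy := zpow_pos h0 m
    generalize q ^ m = y at hy
    rw [neg_one_mul, sub_neg_eq_add, neg_one_mul, sub_neg_eq_add]
    field_simp
    ring
  rw [f1, e1, e2, e3]
  ring

/-- `φ(q)² - φ(q³)²` as a quotient of theta series: both it and `ψ(q⁶)²` are values of the same
Kronecker series, in which the undetermined constant cancels. -/
theorem phi_sq_sub_phi_comp_cube_sq_mul {q : ℝ} (h0 : 0 < q) (h1 : q < 1) :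
    (ramanujanPhi q ^ 2 - ramanujanPhi (q ^ 3) ^ 2) * thetaSeries (q ^ 3) q
      = 4 * q * ramanujanPsi (q ^ 6) * ramanujanPhi (q ^ 3) * thetaSeries (q ^ 3) (q ^ 2) := by
  have hq := h0.ne'
  have p0 : 0 < q ^ 3 := by positivity
  have p1 : q ^ 3 < 1 := pow_lt_one₀ h0.le h1 (by norm_num)
  have p62 : (q ^ 3) ^ 2 < q ^ 2 := by
    rw [← pow_mul]; exact pow_lt_pow_right_of_lt_one₀ h0 h1 (by norm_num)
  have p63 : (q ^ 3) ^ 2 < q ^ 3 := by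
    rw [← pow_mul]; exact pow_lt_pow_right_of_lt_one₀ h0 h1 (by norm_num)
  have p2 : q ^ 2 < 1 := pow_lt_one₀ h0.le h1 (by norm_num)
  have b3 : |q ^ 3| = q ^ 3 := abs_of_pos p0
  have b3' : |-q ^ 3| = q ^ 3 := by rw [abs_neg, b3]
  have b2' : |-q ^ 2| = q ^ 2 := by rw [abs_neg, abs_of_pos (by positivity)]
  have hne : ∀ k : ℤ, q ^ 3 * (q ^ 3) ^ (2 * k) ≠ 1 := by
    intro k h
    rw [← zpow_one_add₀ p0.ne', zpow_eq_one_iff_right₀ p0.le p1.ne] at h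
    omega
  have k1 := kroneckerSeries_mul_thetaSeries (x := -q ^ 2) p0 p1 (by rwa [b2']) (by rwa [b2'])
    p0.ne' hne
  have k2 := kroneckerSeries_mul_thetaSeries (x := -q ^ 3) p0 p1 (by rwa [b3']) (by rwa [b3'])
    p0.ne' hne
  rw [show - -q ^ 2 / q ^ 3 = q⁻¹ by field_simp, thetaSeries_inv,
    show -q ^ 3 * -q ^ 2 / q ^ 3 = q ^ 2 by field_simp,
    ← kroneckerSeries_comm p0 p1 (by rwa [b3]) (by rwa [b3]) (by rwa [b2']) (by rwa [b2'])] at k1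
  rw [show - -q ^ 3 / q ^ 3 = 1 by field_simp, ← ramanujanPhi_eq_thetaSeries,
    show -q ^ 3 * -q ^ 3 / q ^ 3 = q ^ 3 by field_simp, thetaSeries_self p0 p1, ← pow_mul,
    ← kroneckerSeries_comm p0 p1 (by rwa [b3]) (by rwa [b3]) (by rwa [b3']) (by rwa [b3'])] at k2
  norm_num only at k2
  have e6 : kroneckerSeries (q ^ 3) (q ^ 3) (-q ^ 3) = 2 * ramanujanPsi (q ^ 6) ^ 2 := by
    obtain ⟨t, ht0, ht⟩ : ∃ t : ℝ, 0 < t ∧ q ^ 3 = t ^ 2 :=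
      ⟨√(q ^ 3), Real.sqrt_pos.2 p0, (Real.sq_sqrt p0.le).symm⟩
    have ht1 : t < 1 := by
      by_contra h
      nlinarith
    have h := tsum_odd_lambert ht0 ht1
    rw [show q ^ 6 = t ^ 4 by rw [show q ^ 6 = (q ^ 3) ^ 2 by ring, ht]; ring, ht]
    refine mul_left_cancel₀ ht0.ne' ?_
    rw [show t * (2 * ramanujanPsi (t ^ 4) ^ 2) = 2 * t * ramanujanPsi (t ^ 4) ^ 2 by ring, ← h,
      kroneckerSeries, ← tsum_mul_left]
    refine tsum_congr fun k => ?_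
    simp only [← zpow_natCast, ← zpow_mul]
    rw [show 2 * (2 * k + 1) = ((2 : ℕ) : ℤ) + ((2 : ℕ) : ℤ) * (2 * k) by push_cast; ring,
      zpow_add₀ ht0.ne', zpow_add₀ ht0.ne', zpow_one]
    push_cast
    ring
  have hψ := (ramanujanPsi_pos (q := q ^ 6) (by positivity)
    (pow_lt_one₀ h0.le h1 (by norm_num))).ne'
  have hc : kroneckerCoeff (q ^ 3) (q ^ 3) 0 = ramanujanPsi (q ^ 6) * ramanujanPhi (q ^ 3) := by
    refine mul_right_cancel₀ (mul_ne_zero two_ne_zero hψ) ?_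
    rw [← k2, e6]; ring
  rw [phi_sq_sub_phi_comp_cube_sq_eq_kroneckerSeries h0 h1, mul_assoc, k1, hc]
  ring

/-! ### A cubic theta identity -/

theorem tsum_eq_add_shear_three {f : ℤ × ℤ × ℤ → ℝ} (hf : Summable f) :
    ∑' v, f v = ∑' N : ℤ, ∑' w : ℤ × ℤ, f (N - w.1 - w.2, w.1, w.2) := by
  let e : ℤ × ℤ × ℤ ≃ ℤ × ℤ × ℤ :=
    { toFun := fun v => (v.1 - v.2.1 - v.2.2, v.2)
      invFun := fun v => (v.1 + v.2.1 + v.2.2, v.2)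
      left_inv := fun v => by ext <;> simp; ring
      right_inv := fun v => by ext <;> simp; ring }
  rw [← e.tsum_eq f]
  exact Summable.tsum_prod (f := fun v => f (e v)) (hf.comp_injective e.injective)

/-- The product of the three theta series of nome `q³` at `y / q²`, `y` and `y q²` is a multiple,
independent of `y`, of the theta series of nome `q` at `y`: the coefficients of `y^N` and
`y^(N+1)` are matched by `(a, b, c) ↦ (c + 1, a, b)`. -/
theorem exists_thetaSeries_triple_product {q : ℝ} (h0 : 0 < q) (h1 : q < 1) :
    ∃ κ : ℝ, ∀ y : ℝ, y ≠ 0 → thetaSeries (q ^ 3) (y / q ^ 2) * thetaSeries (q ^ 3) y *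
      thetaSeries (q ^ 3) (y * q ^ 2) = κ * thetaSeries q y := by
  have hq := h0.ne'
  have p0 : 0 < q ^ 3 := by positivity
  have p1 : q ^ 3 < 1 := pow_lt_one₀ h0.le h1 (by norm_num)
  let C : ℤ → ℝ := fun N => ∑' w : ℤ × ℤ,
    q ^ (3 * ((N - w.1 - w.2) ^ 2 + w.1 ^ 2 + w.2 ^ 2) - 2 * (N - w.1 - w.2) + 2 * w.2)
  have hC : ∀ N, C (N + 1) = q ^ (2 * N + 1) * 1 * C N := by
    intro N
    simp only [C]
    let e : ℤ × ℤ ≃ ℤ × ℤ :=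
      { toFun := fun w => (N - w.1 - w.2, w.1)
        invFun := fun w => (w.2, N - w.1 - w.2)
        left_inv := fun w => by ext <;> simp; ring
        right_inv := fun w => by ext <;> simp }
    rw [← e.tsum_eq, ← tsum_mul_left]
    refine tsum_congr fun w => ?_
    rw [mul_one, ← zpow_add₀ hq]
    simp only [e, Equiv.coe_fn_mk]
    congr 1
    ring
  refine ⟨C 0, fun y hy => ?_⟩
  have y1 : y / q ^ 2 ≠ 0 := by positivity
  have y2 : y * q ^ 2 ≠ 0 := by positivity
  have s1 := summable_norm_thetaSeries p0 p1 y1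
  have s2 := summable_norm_thetaSeries p0 p1 hy
  have s3 := summable_norm_thetaSeries p0 p1 y2
  have s23 := summable_mul_of_summable_norm s2 s3
  rw [mul_assoc, thetaSeries, thetaSeries, thetaSeries, tsum_mul_tsum_of_summable_norm s2 s3,
    tsum_mul_tsum_of_summable_norm s1 s23.norm,
    tsum_eq_add_shear_three (summable_mul_of_summable_norm s1 s23.norm), thetaSeries,
    ← tsum_mul_left]
  refine tsum_congr fun N => ?_
  have hN := eq_theta_coeff_of_recurrence hq one_ne_zero hC N
  rw [one_zpow, mul_one] at hN
  rw [← mul_assoc, ← hN, ← tsum_mul_right]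
  refine tsum_congr fun w => ?_
  have e1 : y ^ N = y ^ (N - w.1 - w.2) * y ^ w.1 * y ^ w.2 := by
    rw [← zpow_add₀ hy, ← zpow_add₀ hy]; congr 1; ring
  rw [e1, div_eq_mul_inv, mul_zpow, mul_zpow, zpow_add₀ hq, zpow_sub₀ hq]
  simp only [← zpow_natCast, ← zpow_mul, inv_zpow]
  rw [show 3 * ((N - w.1 - w.2) ^ 2 + w.1 ^ 2 + w.2 ^ 2) = ((3 : ℕ) : ℤ) * (N - w.1 - w.2) ^ 2
    + ((3 : ℕ) : ℤ) * w.1 ^ 2 + ((3 : ℕ) : ℤ) * w.2 ^ 2 by push_cast; ring, zpow_add₀ hq,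
    zpow_add₀ hq]
  push_cast
  rw [div_eq_mul_inv]
  ring

/-- The identity `ψ(q²) (φ(q)² - φ(q³)²) = 4 q ψ(q) ψ(q³) ψ(q⁶)` on `(0, 1)`. -/
theorem psi_comp_sq_mul_phi_sq_real {q : ℝ} (h0 : 0 < q) (h1 : q < 1) :
    ramanujanPsi (q ^ 2) * ramanujanPhi q ^ 2 = ramanujanPsi (q ^ 2) * ramanujanPhi (q ^ 3) ^ 2 +
      4 * q * ramanujanPsi q * ramanujanPsi (q ^ 3) * ramanujanPsi (q ^ 6) := by
  have hq := h0.ne'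
  have lt : ∀ n : ℕ, n ≠ 0 → q ^ n < 1 := fun n hn => pow_lt_one₀ h0.le h1 hn
  have p0 : 0 < q ^ 3 := by positivity
  obtain ⟨κ, hκ⟩ := exists_thetaSeries_triple_product h0 h1
  have k1 := hκ 1 one_ne_zero
  have k2 := hκ q hq
  rw [one_mul, one_div, thetaSeries_inv, ← ramanujanPhi_eq_thetaSeries,
    ← ramanujanPhi_eq_thetaSeries] at k1
  rw [show q / q ^ 2 = q⁻¹ by field_simp, thetaSeries_inv, show q * q ^ 2 = q ^ 3 by ring,
    thetaSeries_self p0 (lt 3 (by norm_num)), thetaSeries_self h0 h1, ← pow_mul] at k2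
  norm_num only at k2
  have hm := phi_sq_sub_phi_comp_cube_sq_mul h0 h1
  have a1 := ramanujanPsi_sq h0 h1
  have a3 := ramanujanPsi_sq p0 (lt 3 (by norm_num))
  rw [← pow_mul] at a3
  norm_num only at a3
  have f24 : 0 < thetaSeries (q ^ 3) q := thetaSeries_pos p0 (lt 3 (by norm_num)) h0
  have f15 : 0 < thetaSeries (q ^ 3) (q ^ 2) :=
    thetaSeries_pos p0 (lt 3 (by norm_num)) (by positivity)
  have hφ := ramanujanPhi_pos h0 h1
  have hΦ := ramanujanPhi_pos p0 (lt 3 (by norm_num))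
  have h1' := ramanujanPsi_pos h0 h1
  have h2' := ramanujanPsi_pos (q := q ^ 2) (by positivity) (lt 2 (by norm_num))
  have h3' := ramanujanPsi_pos p0 (lt 3 (by norm_num))
  have h6' := ramanujanPsi_pos (q := q ^ 6) (by positivity) (lt 6 (by norm_num))
  generalize thetaSeries (q ^ 3) q = F at *
  generalize thetaSeries (q ^ 3) (q ^ 2) = G at *
  generalize ramanujanPhi (q ^ 3) = Φ at *
  generalize ramanujanPhi q = φ at *
  generalize ramanujanPsi (q ^ 2) = ψ2 at *
  generalize ramanujanPsi (q ^ 3) = ψ3 at *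
  generalize ramanujanPsi (q ^ 6) = ψ6 at *
  generalize ramanujanPsi q = ψ1 at *
  -- the squares of the two sides of `ψ2 Φ G = ψ1 ψ3 F` agree after elimination of `κ`
  have e : ψ2 * Φ * G = ψ1 * ψ3 * F := by
    refine (sq_eq_sq₀ (by positivity) (by positivity)).1 ?_
    refine mul_left_cancel₀ (mul_ne_zero hΦ.ne' h2'.ne') ?_
    have e1 : Φ * G ^ 2 * ψ2 = φ * ψ6 * F ^ 2 := by
      linear_combination ψ2 * k1 - (φ / 2) * k2
    calc Φ * ψ2 * (ψ2 * Φ * G) ^ 2 = ψ2 ^ 2 * Φ ^ 2 * (Φ * G ^ 2 * ψ2) := by ring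
      _ = Φ * ψ2 * ((φ * ψ2) * (Φ * ψ6) * F ^ 2) := by rw [e1]; ring
      _ = Φ * ψ2 * (ψ1 * ψ3 * F) ^ 2 := by rw [← a1, ← a3]; ring
  refine mul_right_cancel₀ f24.ne' ?_
  linear_combination ψ2 * hm + 4 * q * ψ6 * e

/-! ### Modular equations of degree three -/

open Set in
theorem continuousOn_ramanujan_comp_pow {n : ℕ} (hn : n ≠ 0) :
    ContinuousOn (fun q : ℝ => ramanujanPhi (q ^ n)) (Ico 0 1) ∧
      ContinuousOn (fun q : ℝ => ramanujanPhi (-q ^ n)) (Ico 0 1) ∧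
      ContinuousOn (fun q : ℝ => ramanujanPsi (q ^ n)) (Ico 0 1) := by
  have h : ∀ q ∈ Ico (0 : ℝ) 1, ‖q ^ n‖ < 1 := fun q hq => by
    rw [norm_pow, Real.norm_eq_abs, abs_of_nonneg hq.1]
    exact pow_lt_one₀ hq.1 hq.2 hn
  refine ⟨fun q hq => ?_, fun q hq => ?_, fun q hq => ?_⟩
  · refine ContinuousAt.continuousWithinAt (ContinuousAt.comp (g := (ramanujanPhi : ℝ → ℝ))
      (continuousAt_ramanujanPhi (h q hq)) (by fun_prop))
  · refine ContinuousAt.continuousWithinAt (ContinuousAt.comp (g := (ramanujanPhi : ℝ → ℝ))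
      (continuousAt_ramanujanPhi (by rw [norm_neg]; exact h q hq)) (by fun_prop))
  · refine ContinuousAt.continuousWithinAt (ContinuousAt.comp (g := (ramanujanPsi : ℝ → ℝ))
      (continuousAt_ramanujanPsi (h q hq)) (by fun_prop))

/-- The equation between squares is the classical modular equation of degree three, cleared of
denominators; it is the result of eliminating `φ(-q)` and `φ(-q³)` between the two quartic
identities and `ramanujanPhi_mul_sub_mul`. -/
theorem modular_equation_cleared_sq {q : ℝ} (h0 : 0 < q) (h1 : q < 1) :
    (ramanujanPsi (q ^ 2) ^ 2 * ramanujanPhi (q ^ 3) ^ 2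
        - q * ramanujanPsi (q ^ 6) ^ 2 * ramanujanPhi q ^ 2) ^ 2
      = (ramanujanPsi q * ramanujanPsi (q ^ 3)
        * (ramanujanPhi (-q) * ramanujanPhi (-q ^ 3))) ^ 2 := by
  have p0 : 0 < q ^ 3 := by positivity
  have p1 : q ^ 3 < 1 := pow_lt_one₀ h0.le h1 (by norm_num)
  have j1 := ramanujanPhi_pow_four_sub h0 h1
  have j3 := ramanujanPhi_pow_four_sub p0 p1
  have a1 := ramanujanPsi_sq h0 h1
  have a3 := ramanujanPsi_sq p0 p1
  have e := ramanujanPhi_mul_sub_mul h0 h1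
  rw [← pow_mul] at j3 a3
  norm_num only at j3 a3
  rw [mul_pow, mul_pow, a1, a3]
  generalize ramanujanPhi (q ^ 3) = Φ at *
  generalize ramanujanPhi q = φ at *
  generalize ramanujanPhi (-q ^ 3) = Φm at *
  generalize ramanujanPhi (-q) = φm at *
  generalize ramanujanPsi (q ^ 2) = ψ2 at *
  generalize ramanujanPsi (q ^ 6) = ψ6 at *
  have e1 : φm * Φm = φ * Φ - 4 * q * ψ2 * ψ6 := by linarith
  have e2 : (φ * Φ - 4 * q * ψ2 * ψ6) ^ 4
      = (φ ^ 4 - 16 * q * ψ2 ^ 4) * (Φ ^ 4 - 16 * q ^ 3 * ψ6 ^ 4) := by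
    rw [← e1, ← j1, ← j3]; ring
  rw [e1]
  refine mul_left_cancel₀ (mul_ne_zero (by norm_num : (16 : ℝ) ≠ 0) h0.ne') ?_
  linear_combination e2

open Set in
/-- The square root of `modular_equation_cleared_sq`; its sign is fixed by continuity. -/
theorem modular_equation_cleared {q : ℝ} (h0 : 0 < q) (h1 : q < 1) :
    ramanujanPsi (q ^ 2) ^ 2 * ramanujanPhi (q ^ 3) ^ 2
        - q * ramanujanPsi (q ^ 6) ^ 2 * ramanujanPhi q ^ 2
      = ramanujanPsi q * ramanujanPsi (q ^ 3)
        * (ramanujanPhi (-q) * ramanujanPhi (-q ^ 3)) := by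
  obtain ⟨c1, c1m, d1⟩ := continuousOn_ramanujan_comp_pow one_ne_zero
  obtain ⟨c3, c3m, d3⟩ := continuousOn_ramanujan_comp_pow three_ne_zero
  have d2 := (continuousOn_ramanujan_comp_pow two_ne_zero).2.2
  have d6 := (continuousOn_ramanujan_comp_pow (n := 6) (by norm_num)).2.2
  simp only [pow_one] at c1 c1m d1
  have hpos : ∀ q ∈ Ico (0 : ℝ) 1, 0 < ramanujanPsi q * ramanujanPsi (q ^ 3)
        * (ramanujanPhi (-q) * ramanujanPhi (-q ^ 3)) := by
    rintro q ⟨h0, h1⟩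
    rcases h0.eq_or_lt with rfl | h0
    · simp [ramanujanPhi_zero, ramanujanPsi_zero]
    have p0 : 0 < q ^ 3 := by positivity
    have p1 : q ^ 3 < 1 := pow_lt_one₀ h0.le h1 (by norm_num)
    have := ramanujanPhi_neg_pos h0 h1
    have := ramanujanPhi_neg_pos p0 p1
    have := ramanujanPsi_pos h0 h1
    have := ramanujanPsi_pos p0 p1
    positivity
  -- both sides are continuous on `[0, 1)`, and they agree at `q = 0`
  refine isPreconnected_Ico.eq_of_sq_eq (S := Ico (0 : ℝ) 1)
    (f := fun q => ramanujanPsi (q ^ 2) ^ 2 * ramanujanPhi (q ^ 3) ^ 2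
        - q * ramanujanPsi (q ^ 6) ^ 2 * ramanujanPhi q ^ 2)
    (g := fun q => ramanujanPsi q * ramanujanPsi (q ^ 3)
        * (ramanujanPhi (-q) * ramanujanPhi (-q ^ 3)))
    (by fun_prop) (by fun_prop) ?_ (fun {q} hq => (hpos q hq).ne')
    (y := 0) ⟨le_rfl, one_pos⟩ ?_ ⟨h0.le, h1⟩
  · rintro q ⟨h0, h1⟩
    rcases h0.eq_or_lt with rfl | h0
    · simp [ramanujanPhi_zero, ramanujanPsi_zero]
    · exact modular_equation_cleared_sq h0 h1
  · simp [ramanujanPhi_zero, ramanujanPsi_zero]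

theorem psi_mul_phi_sq_real {q : ℝ} (h0 : 0 < q) (h1 : q < 1) :
    ramanujanPsi q * ramanujanPhi q ^ 2 = ramanujanPsi q * ramanujanPhi (q ^ 3) ^ 2 +
      4 * q * ramanujanPsi (q ^ 3) * ramanujanPsi (q ^ 6) * ramanujanPhi q := by
  have h2 := ramanujanPsi_pos (q := q ^ 2) (by positivity) (pow_lt_one₀ h0.le h1 two_ne_zero)
  refine mul_left_cancel₀ h2.ne' ?_
  linear_combination ramanujanPsi q * psi_comp_sq_mul_phi_sq_real h0 h1 +
    4 * q * ramanujanPsi (q ^ 3) * ramanujanPsi (q ^ 6) * ramanujanPsi_sq h0 h1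

theorem phi_mul_psi_comp_sq_sq_real {q : ℝ} (h0 : 0 < q) (h1 : q < 1) :
    ramanujanPhi q * ramanujanPsi (q ^ 2) ^ 2 =
      ramanujanPsi q * ramanujanPsi (q ^ 3) * ramanujanPhi (q ^ 3) +
        q * ramanujanPhi q * ramanujanPsi (q ^ 6) ^ 2 := by
  refine mul_left_cancel₀ (ramanujanPhi_pos h0 h1).ne' ?_
  linear_combination modular_equation_cleared h0 h1
    - ramanujanPsi q * ramanujanPsi (q ^ 3) * ramanujanPhi_mul_sub_mul h0 h1
    + ramanujanPsi (q ^ 2) * psi_comp_sq_mul_phi_sq_real h0 h1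

theorem ramanujanAlpha_eq {q : ℝ} (h0 : 0 < q) (h1 : q < 1) :
    ramanujanAlpha q = 16 * q * ramanujanPsi (q ^ 2) ^ 4 / ramanujanPhi q ^ 4 := by
  have := ramanujanPhi_pos h0 h1
  rw [ramanujanAlpha, ← ramanujanPhi_pow_four_sub h0 h1]
  field_simp

/-- The modular equations of degree three in terms of `u = α^(1/8)` and `v = β^(1/8)`. -/
theorem exists_eighth_roots {q : ℝ} (h0 : 0 < q) (h1 : q < 1) :
    ∃ u v : ℝ, 0 < u ∧ 0 < v ∧ ramanujanAlpha q = u ^ 8 ∧ ramanujanBeta 3 q = v ^ 8 ∧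
      (ramanujanMultiplier 3 q - 1) * u = 2 * v ^ 3 ∧
      ramanujanMultiplier 3 q * u ^ 4 = v ^ 4 + 2 * u * v := by
  have p0 : 0 < q ^ 3 := by positivity
  have p1 : q ^ 3 < 1 := pow_lt_one₀ h0.le h1 (by norm_num)
  have hα := ramanujanAlpha_eq h0 h1
  have hβ := ramanujanAlpha_eq p0 p1
  rw [← pow_mul] at hβ
  norm_num only at hβ
  have hA := psi_comp_sq_mul_phi_sq_real h0 h1
  have hC := phi_mul_psi_comp_sq_sq_real h0 h1
  have a1 := ramanujanPsi_sq h0 h1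
  have a3 := ramanujanPsi_sq p0 p1
  rw [← pow_mul] at a3
  norm_num only at a3
  have hφ := ramanujanPhi_pos h0 h1
  have hΦ := ramanujanPhi_pos p0 p1
  have h1' := ramanujanPsi_pos h0 h1
  have h2' := ramanujanPsi_pos (q := q ^ 2) (by positivity) (pow_lt_one₀ h0.le h1 (by norm_num))
  have h3' := ramanujanPsi_pos p0 p1
  have h6' := ramanujanPsi_pos (q := q ^ 6) (by positivity) (pow_lt_one₀ h0.le h1 (by norm_num))
  rw [ramanujanBeta, hα, hβ, ramanujanMultiplier]
  generalize ramanujanPhi (q ^ 3) = Φ at *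
  generalize ramanujanPhi q = φ at *
  generalize ramanujanPsi (q ^ 2) = ψ2 at *
  generalize ramanujanPsi (q ^ 3) = ψ3 at *
  generalize ramanujanPsi (q ^ 6) = ψ6 at *
  generalize ramanujanPsi q = ψ1 at *
  obtain ⟨r, hr, rfl⟩ : ∃ r : ℝ, 0 < r ∧ q = r ^ 4 :=
    ⟨√(√q), Real.sqrt_pos.2 (Real.sqrt_pos.2 h0), by
      rw [show √(√q) ^ 4 = (√(√q) ^ 2) ^ 2 by ring, Real.sq_sqrt (Real.sqrt_nonneg _),
        Real.sq_sqrt h0.le]⟩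
  have hx : 0 < 2 * r * ψ2 / φ := by positivity
  have hX : 0 < 2 * r ^ 3 * ψ6 / Φ := by positivity
  have hu := Real.sq_sqrt hx.le
  have hv := Real.sq_sqrt hX.le
  have hu0 := Real.sqrt_pos.2 hx
  have hv0 := Real.sqrt_pos.2 hX
  generalize √(2 * r * ψ2 / φ) = u at *
  generalize √(2 * r ^ 3 * ψ6 / Φ) = v at *
  refine ⟨u, v, hu0, hv0, ?_, ?_, ?_, ?_⟩
  · rw [show u ^ 8 = (u ^ 2) ^ 4 by ring, hu]; field_simp; norm_num
  · rw [show v ^ 8 = (v ^ 2) ^ 4 by ring, hv]; field_simp; norm_num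
  · have e1 : φ ^ 2 / Φ ^ 2 - 1 = 4 * r ^ 4 * ψ1 * ψ3 * ψ6 / (ψ2 * Φ ^ 2) := by
      field_simp; linarith
    rw [e1]
    refine (sq_eq_sq₀ (by positivity) (by positivity)).1 ?_
    rw [mul_pow, hu, mul_pow, show (v ^ 3) ^ 2 = (v ^ 2) ^ 3 by ring, hv, div_pow,
      show (4 * r ^ 4 * ψ1 * ψ3 * ψ6) ^ 2 = 16 * r ^ 8 * ψ1 ^ 2 * ψ3 ^ 2 * ψ6 ^ 2 by ring, a1, a3]
    field_simp
    norm_num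
  · have e1 : φ ^ 2 / Φ ^ 2 * u ^ 4 - v ^ 4 = 4 * r ^ 2 * ψ1 * ψ3 / (φ * Φ) := by
      rw [show u ^ 4 = (u ^ 2) ^ 2 by ring, hu, show v ^ 4 = (v ^ 2) ^ 2 by ring, hv]
      field_simp
      linear_combination 4 * hC
    have e2 : 4 * r ^ 2 * ψ1 * ψ3 / (φ * Φ) = 2 * u * v := by
      refine (sq_eq_sq₀ (by positivity) (by positivity)).1 ?_
      rw [mul_pow, mul_pow, hu, hv, div_pow,
        show (4 * r ^ 2 * ψ1 * ψ3) ^ 2 = 16 * r ^ 4 * ψ1 ^ 2 * ψ3 ^ 2 by ring, a1, a3]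
      field_simp
      norm_num
    linarith

theorem pow_eight_rpow {u : ℝ} (hu : 0 < u) (n : ℕ) {s : ℝ} (hs : 8 * s = n) :
    (u ^ 8) ^ s = u ^ n := by
  rw [← Real.rpow_natCast u 8, ← Real.rpow_mul hu.le, ← Real.rpow_natCast u n, ← hs]
  norm_num

theorem modular_equations_degree_three {q : ℝ} (h0 : 0 < q) (h1 : q < 1) :
    ramanujanMultiplier 3 q - 1 =
        2 * (ramanujanBeta 3 q ^ (3 / 8 : ℝ) / ramanujanAlpha q ^ (1 / 8 : ℝ)) ∧
      ramanujanMultiplier 3 q =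
        ramanujanBeta 3 q ^ (1 / 2 : ℝ) / ramanujanAlpha q ^ (1 / 2 : ℝ) +
          2 * (ramanujanBeta 3 q ^ (1 / 8 : ℝ) / ramanujanAlpha q ^ (3 / 8 : ℝ)) := by
  obtain ⟨u, v, hu, hv, hα, hβ, e1, e2⟩ := exists_eighth_roots h0 h1
  have w1 {w : ℝ} (hw : 0 < w) : (w ^ 8) ^ (1 / 8 : ℝ) = w ^ 1 := pow_eight_rpow hw 1 (by norm_num)
  have w3 {w : ℝ} (hw : 0 < w) : (w ^ 8) ^ (3 / 8 : ℝ) = w ^ 3 := pow_eight_rpow hw 3 (by norm_num)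
  have w4 {w : ℝ} (hw : 0 < w) : (w ^ 8) ^ (1 / 2 : ℝ) = w ^ 4 := pow_eight_rpow hw 4 (by norm_num)
  rw [hα, hβ, w1 hu, w3 hu, w4 hu, w1 hv, w3 hv, w4 hv]
  constructor
  · field_simp
    linarith
  · field_simp
    linarith

/-- The parameter lies in `(0, 1)` because `α < 1`. -/
theorem lt_one_of_parametrization_lt_one {p : ℝ} (hp : 0 < p)
    (h : p * (2 + p) ^ 3 / (1 + 2 * p) ^ 3 < 1) : p < 1 := by
  rw [div_lt_one (by positivity)] at h
  by_contra! hp1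
  -- `(1 + 2p)³ - p (2 + p)³ = (1 - p)³ (1 + p)`
  have : 0 ≤ (p - 1) ^ 3 * (1 + p) := by
    have := sub_nonneg.2 hp1
    positivity
  linarith [this, h, show (p - 1) ^ 3 * (1 + p) = p * (2 + p) ^ 3 - (1 + 2 * p) ^ 3 by ring]

/-- Monotonicity is visible on `1 - α = (1 - p)² (1 - p²) / (1 + 2 p)³`. -/
theorem parametrization_strictMonoOn :
    StrictMonoOn (fun p : ℝ => p * (2 + p) ^ 3 / (1 + 2 * p) ^ 3) (Set.Ioo 0 1) := by
  rintro p ⟨hp0, hp1⟩ r ⟨hr0, hr1⟩ h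
  have e : ∀ t : ℝ, 0 < t → t * (2 + t) ^ 3 / (1 + 2 * t) ^ 3
      = 1 - (1 - t) ^ 2 * (1 - t ^ 2) / (1 + 2 * t) ^ 3 := by
    intro t ht
    field_simp
    ring
  simp only
  rw [e p hp0, e r hr0]
  have h1 : (1 - r) ^ 2 * (1 - r ^ 2) < (1 - p) ^ 2 * (1 - p ^ 2) :=
    mul_lt_mul'' (by nlinarith) (by nlinarith) (by positivity) (by nlinarith)
  have h2 : (1 + 2 * p) ^ 3 ≤ (1 + 2 * r) ^ 3 := by gcongr
  have h3 : 0 ≤ (1 - p) ^ 2 * (1 - p ^ 2) := mul_nonneg (sq_nonneg _) (by nlinarith)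
  have := div_lt_div₀ h1 h2 h3 (by positivity)
  linarith

theorem parametrization_degree_three {q p : ℝ} (h0 : 0 < q) (h1 : q < 1) (hp : 0 < p)
    (h : ramanujanAlpha q = p * (2 + p) ^ 3 / (1 + 2 * p) ^ 3) :
    ramanujanBeta 3 q = p ^ 3 * (2 + p) / (1 + 2 * p) ∧
      ramanujanMultiplier 3 q = 1 + 2 * p := by
  obtain ⟨u, v, hu, hv, hα, hβ, e1, e2⟩ := exists_eighth_roots h0 h1
  have hlt : ramanujanAlpha q < 1 := by
    have := ramanujanPhi_pos h0 h1
    have := ramanujanPhi_neg_pos h0 h1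
    rw [ramanujanAlpha]
    linarith [show 0 < ramanujanPhi (-q) ^ 4 / ramanujanPhi q ^ 4 by positivity]
  -- the multiplier provides the solution `r = (m - 1) / 2 = v³ / u` of the same equation
  obtain ⟨r, hr⟩ : ∃ r, r = v ^ 3 / u := ⟨_, rfl⟩
  have hr0 : 0 < r := by rw [hr]; positivity
  have hm : ramanujanMultiplier 3 q = 1 + 2 * r := by
    rw [hr]; field_simp; linarith
  have hm2 : 1 + 2 * r = v / u ^ 3 * (2 + r) := by
    rw [← hm]
    refine mul_right_cancel₀ (pow_ne_zero 4 hu.ne') ?_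
    rw [e2, hr]
    field_simp
    ring
  have hα' : ramanujanAlpha q = r * (2 + r) ^ 3 / (1 + 2 * r) ^ 3 := by
    rw [hα, hm2, hr]
    field_simp
  have hβ' : ramanujanBeta 3 q = r ^ 3 * (2 + r) / (1 + 2 * r) := by
    rw [hβ, hm2, hr]
    field_simp
  have hpr : p = r := by
    refine parametrization_strictMonoOn.injOn
      ⟨hp, lt_one_of_parametrization_lt_one hp (h ▸ hlt)⟩
      ⟨hr0, lt_one_of_parametrization_lt_one hr0 (hα' ▸ hlt)⟩ ?_
    rw [← h, ← hα']
  rw [hpr]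
  exact ⟨hβ', hm⟩

/-! ### Passage to the complex unit disc -/

theorem IsSummableExponent.differentiableOn {ι : Type*} {E : ι → ℕ} (h : IsSummableExponent E) :
    DifferentiableOn ℂ (fun q : ℂ => ∑' v, q ^ E v) (Metric.ball 0 1) := by
  intro q hq
  obtain ⟨r, hr, hr1⟩ := exists_between (mem_ball_zero_iff.1 hq)
  have hd : DifferentiableOn ℂ (fun q : ℂ => ∑' v, q ^ E v) (Metric.ball 0 r) := by
    refine Complex.differentiableOn_tsum_of_summable_norm (u := fun v => r ^ E v)
      (h r ((norm_nonneg q).trans hr.le) hr1) (fun v => by fun_prop) Metric.isOpen_ball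
      fun v x hx => ?_
    rw [norm_pow]
    exact pow_le_pow_left₀ (norm_nonneg x) (mem_ball_zero_iff.1 hx).le _
  exact (hd.differentiableAt (Metric.isOpen_ball.mem_nhds
    (mem_ball_zero_iff.2 hr))).differentiableWithinAt

theorem mapsTo_pow_unit_ball {n : ℕ} (hn : n ≠ 0) :
    Set.MapsTo (fun q : ℂ => q ^ n) (Metric.ball 0 1) (Metric.ball 0 1) := by
  intro q hq
  rw [mem_ball_zero_iff] at hq ⊢
  rw [norm_pow]
  exact pow_lt_one₀ (norm_nonneg q) hq hn

theorem differentiableOn_ramanujan_comp_pow {n : ℕ} (hn : n ≠ 0) :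
    DifferentiableOn ℂ (fun q : ℂ => ramanujanPhi (q ^ n)) (Metric.ball 0 1) ∧
      DifferentiableOn ℂ (fun q : ℂ => ramanujanPsi (q ^ n)) (Metric.ball 0 1) := by
  have h1 : DifferentiableOn ℂ (ramanujanPhi : ℂ → ℂ) (Metric.ball 0 1) := by
    rw [funext ramanujanPhi_eq_tsum]
    exact isSummableExponent_sq.differentiableOn
  have h2 : DifferentiableOn ℂ (ramanujanPsi : ℂ → ℂ) (Metric.ball 0 1) := by
    rw [funext ramanujanPsi_eq_tsum]
    exact isSummableExponent_two_mul_sq_add.differentiableOn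
  have hp : DifferentiableOn ℂ (fun q : ℂ => q ^ n) (Metric.ball 0 1) := by fun_prop
  exact ⟨h1.comp hp (mapsTo_pow_unit_ball hn), h2.comp hp (mapsTo_pow_unit_ball hn)⟩

open Filter Topology in
theorem eq_on_unit_disc_of_eq_on_Ioo {f g : ℂ → ℂ} (hf : DifferentiableOn ℂ f (Metric.ball 0 1))
    (hg : DifferentiableOn ℂ g (Metric.ball 0 1))
    (h : ∀ q : ℝ, 0 < q → q < 1 → f q = g q) {q : ℂ} (hq : ‖q‖ < 1) : f q = g q := by
  have hfr : ∃ᶠ z : ℂ in 𝓝[≠] 0, f z = g z := by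
    have ht : Tendsto (fun x : ℝ => (x : ℂ)) (𝓝[>] 0) (𝓝[≠] 0) := by
      refine tendsto_nhdsWithin_iff.2 ⟨?_, ?_⟩
      · have : ContinuousAt (fun x : ℝ => (x : ℂ)) 0 := Complex.continuous_ofReal.continuousAt
        simpa [ContinuousAt] using this.mono_left nhdsWithin_le_nhds
      · filter_upwards [self_mem_nhdsWithin] with x hx
        simpa using (Set.mem_Ioi.1 hx).ne'
    refine ht.frequently (Eventually.frequently ?_)
    have hev : ∀ᶠ q : ℝ in 𝓝[>] 0, 0 < q ∧ q < 1 := Ioo_mem_nhdsGT one_pos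
    filter_upwards [hev] with x hx using h x hx.1 hx.2
  exact (hf.analyticOnNhd Metric.isOpen_ball).eqOn_of_preconnected_of_frequently_eq
    (hg.analyticOnNhd Metric.isOpen_ball) (convex_ball 0 1).isPreconnected
    (Metric.mem_ball_self one_pos) hfr (mem_ball_zero_iff.2 hq)

theorem ofReal_ramanujanPhi (q : ℝ) : ((ramanujanPhi q : ℝ) : ℂ) = ramanujanPhi (q : ℂ) := by
  rw [ramanujanPhi_eq_tsum, ramanujanPhi_eq_tsum, Complex.ofReal_tsum]
  push_cast
  rfl

theorem ofReal_ramanujanPsi (q : ℝ) : ((ramanujanPsi q : ℝ) : ℂ) = ramanujanPsi (q : ℂ) := by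
  rw [ramanujanPsi_eq_tsum, ramanujanPsi_eq_tsum, Complex.ofReal_tsum]
  push_cast
  rfl

theorem theta_identities_degree_three {q : ℂ} (hq : ‖q‖ < 1) :
    ramanujanPsi (q ^ 2) * ramanujanPhi q ^ 2 =
        ramanujanPsi (q ^ 2) * ramanujanPhi (q ^ 3) ^ 2 +
          4 * q * ramanujanPsi q * ramanujanPsi (q ^ 3) * ramanujanPsi (q ^ 6) ∧
      ramanujanPsi q * ramanujanPhi q ^ 2 =
        ramanujanPsi q * ramanujanPhi (q ^ 3) ^ 2 +
          4 * q * ramanujanPsi (q ^ 3) * ramanujanPsi (q ^ 6) * ramanujanPhi q ∧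
      ramanujanPhi q * ramanujanPsi (q ^ 2) ^ 2 =
        ramanujanPsi q * ramanujanPsi (q ^ 3) * ramanujanPhi (q ^ 3) +
          q * ramanujanPhi q * ramanujanPsi (q ^ 6) ^ 2 := by
  obtain ⟨c1, d1⟩ := differentiableOn_ramanujan_comp_pow one_ne_zero
  obtain ⟨c3, d3⟩ := differentiableOn_ramanujan_comp_pow three_ne_zero
  have d2 := (differentiableOn_ramanujan_comp_pow two_ne_zero).2
  have d6 := (differentiableOn_ramanujan_comp_pow (n := 6) (by norm_num)).2
  simp only [pow_one] at c1 d1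
  refine ⟨?_, ?_, ?_⟩
  · refine eq_on_unit_disc_of_eq_on_Ioo
      (f := fun q => ramanujanPsi (q ^ 2) * ramanujanPhi q ^ 2)
      (g := fun q => ramanujanPsi (q ^ 2) * ramanujanPhi (q ^ 3) ^ 2 +
          4 * q * ramanujanPsi q * ramanujanPsi (q ^ 3) * ramanujanPsi (q ^ 6))
      (by fun_prop) (by fun_prop) (fun q h0 h1 => ?_) hq
    have := congrArg (fun x : ℝ => (x : ℂ)) (psi_comp_sq_mul_phi_sq_real h0 h1)
    push_cast [ofReal_ramanujanPhi, ofReal_ramanujanPsi] at this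
    exact this
  · refine eq_on_unit_disc_of_eq_on_Ioo
      (f := fun q => ramanujanPsi q * ramanujanPhi q ^ 2)
      (g := fun q => ramanujanPsi q * ramanujanPhi (q ^ 3) ^ 2 +
          4 * q * ramanujanPsi (q ^ 3) * ramanujanPsi (q ^ 6) * ramanujanPhi q)
      (by fun_prop) (by fun_prop) (fun q h0 h1 => ?_) hq
    have := congrArg (fun x : ℝ => (x : ℂ)) (psi_mul_phi_sq_real h0 h1)
    push_cast [ofReal_ramanujanPhi, ofReal_ramanujanPsi] at this
    exact this
  · refine eq_on_unit_disc_of_eq_on_Ioo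
      (f := fun q => ramanujanPhi q * ramanujanPsi (q ^ 2) ^ 2)
      (g := fun q => ramanujanPsi q * ramanujanPsi (q ^ 3) * ramanujanPhi (q ^ 3) +
          q * ramanujanPhi q * ramanujanPsi (q ^ 6) ^ 2)
      (by fun_prop) (by fun_prop) (fun q h0 h1 => ?_) hq
    have := congrArg (fun x : ℝ => (x : ℂ)) (phi_mul_psi_comp_sq_sq_real h0 h1)
    push_cast [ofReal_ramanujanPhi, ofReal_ramanujanPsi] at this
    exact this

/-! ### Coefficients of theta products -/

theorem IsSummableExponent.add {ι κ : Type*} {E : ι → ℕ} {F : κ → ℕ} (hE : IsSummableExponent E)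
    (hF : IsSummableExponent F) : IsSummableExponent fun v : ι × κ => E v.1 + F v.2 := by
  intro r h0 h1
  have h : Summable fun v : ι × κ => r ^ E v.1 * r ^ F v.2 :=
    summable_mul_of_summable_norm (f := fun v => r ^ E v) (g := fun v => r ^ F v)
      (hE r h0 h1).norm (hF r h0 h1).norm
  simpa only [pow_add] using h

theorem IsSummableExponent.const_mul {ι : Type*} {E : ι → ℕ} (hE : IsSummableExponent E) {n : ℕ}
    (hn : n ≠ 0) : IsSummableExponent fun v => n * E v := by
  intro r h0 h1
  simpa [pow_mul] using hE (r ^ n) (pow_nonneg h0 n) (pow_lt_one₀ h0 h1 hn)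

theorem IsSummableExponent.add_one {ι : Type*} {E : ι → ℕ} (hE : IsSummableExponent E) :
    IsSummableExponent fun v => E v + 1 := by
  intro r h0 h1
  simpa [pow_succ] using (hE r h0 h1).mul_right r

theorem IsSummableExponent.tsum_mul {ι κ : Type*} {E : ι → ℕ} {F : κ → ℕ}
    (hE : IsSummableExponent E) (hF : IsSummableExponent F) {q : ℂ} (hq : ‖q‖ < 1) :
    (∑' v, q ^ E v) * ∑' v, q ^ F v = ∑' v : ι × κ, q ^ (E v.1 + F v.2) := by
  refine (tsum_mul_tsum_of_summable_norm (f := fun v => q ^ E v) (g := fun v => q ^ F v)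
    (hE.summable_norm hq) (hF.summable_norm hq)).trans ?_
  exact tsum_congr fun v => (pow_add q _ _).symm

/-- The coefficients of `∑ q^(E v)` count the fibres of `E`. -/
theorem IsSummableExponent.hasSum_ncard {ι : Type*} {E : ι → ℕ} (hE : IsSummableExponent E)
    {q : ℂ} (hq : ‖q‖ < 1) :
    HasSum (fun N : ℕ => (({v | E v = N}.ncard : ℝ) : ℂ) * q ^ N) (∑' v, q ^ E v) := by
  have h := (hE.summable_norm hq).of_norm.hasSum.tsum_fiberwise E
  refine h.congr_fun fun N => ?_
  have e : ∀ b : E ⁻¹' {N}, q ^ E b = q ^ N := fun b => by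
    have hb : E b = N := b.2
    rw [hb]
  rw [tsum_congr e, tsum_const, nsmul_eq_mul, Complex.ofReal_natCast]
  rfl

open Filter Topology in
theorem coeff_eq_of_hasSum_eq {a b : ℕ → ℂ} {f : ℂ → ℂ}
    (ha : ∀ q : ℂ, ‖q‖ < 1 → HasSum (fun N => a N * q ^ N) (f q))
    (hb : ∀ q : ℂ, ‖q‖ < 1 → HasSum (fun N => b N * q ^ N) (f q)) (N : ℕ) : a N = b N := by
  have key : ∀ a : ℕ → ℂ, (∀ q : ℂ, ‖q‖ < 1 → HasSum (fun N => a N * q ^ N) (f q)) →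
      HasFPowerSeriesAt f (FormalMultilinearSeries.ofScalars ℂ a) 0 := by
    intro a ha
    rw [hasFPowerSeriesAt_iff]
    filter_upwards [Metric.ball_mem_nhds (0 : ℂ) one_pos] with z hz
    have := ha z (mem_ball_zero_iff.1 hz)
    simpa [mul_comm] using this
  have := (key a ha).eq_formalMultilinearSeries (key b hb)
  have h2 := congrArg (fun p => FormalMultilinearSeries.coeff p N) this
  simpa using h2

/-- The triangular number `u (u + 1) / 2`, for `u ∈ ℤ`. -/
def triangular (u : ℤ) : ℕ := ((u ^ 2 + u) / 2).toNat

theorem two_mul_triangular (u : ℤ) : 2 * (triangular u : ℤ) = u ^ 2 + u := by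
  obtain ⟨k, hk⟩ : Even (u * (u + 1)) := Int.even_mul_succ_self u
  have h0 : 0 ≤ u * (u + 1) := by
    rcases lt_or_ge u 0 with h | h <;> nlinarith
  have h1 : u ^ 2 + u = 2 * k := by linarith
  rw [triangular, h1, Int.mul_ediv_cancel_left _ two_ne_zero, Int.toNat_of_nonneg (by omega)]

theorem isSummableExponent_triangular : IsSummableExponent triangular :=
  isSummableExponent_of_natAbs_le fun n => by
    have h := two_mul_triangular n
    have : 2 * (n.natAbs : ℤ) ≤ n ^ 2 + n + 2 := by
      rw [Int.natCast_natAbs]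
      rcases abs_cases n with ⟨h, h'⟩ | ⟨h, h'⟩ <;> rw [h]
      · nlinarith [Int.le_self_sq n]
      · -- `n² + 3 n + 2 = (n + 1) (n + 2)` is not negative at an integer
        have : 0 ≤ (n + 1) * (n + 2) := by
          rcases (by omega : n = -1 ∨ n ≤ -2) with rfl | h2
          · norm_num
          · nlinarith
        linarith
    omega

theorem tsum_pow_sq (q : ℂ) : ∑' n : ℤ, q ^ (n.natAbs ^ 2) = ramanujanPhi q :=
  (ramanujanPhi_eq_tsum q).symm

theorem tsum_pow_triangular {q : ℂ} (hq : ‖q‖ < 1) :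
    ∑' n : ℤ, q ^ triangular n = 2 * ramanujanPsi q := by
  rw [tsum_even_add_odd_int (isSummableExponent_triangular.summable_norm hq).of_norm, two_mul,
    ramanujanPsi_eq_tsum]
  congr 1
  · refine tsum_congr fun n => ?_
    congr 1
    have h := two_mul_triangular (2 * n)
    rw [show (2 * n) ^ 2 + 2 * n = 2 * (2 * n ^ 2 + n) by ring] at h
    omega
  · rw [← (Equiv.subLeft (-1 : ℤ)).tsum_eq]
    refine tsum_congr fun n => ?_
    congr 1
    have h := two_mul_triangular (2 * (-1 - n) + 1)
    rw [show (2 * (-1 - n) + 1) ^ 2 + (2 * (-1 - n) + 1) = 2 * (2 * n ^ 2 + n) by ring] at h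
    simp only [Equiv.subLeft_apply]
    omega

theorem tsum_pow_const_mul {ι : Type*} (E : ι → ℕ) (n : ℕ) (q : ℂ) :
    ∑' v, q ^ (n * E v) = ∑' v, (q ^ n) ^ E v := by
  simp only [pow_mul]

theorem IsSummableExponent.tsum_mul_three {ι κ μ : Type*} {E : ι → ℕ} {F : κ → ℕ} {G : μ → ℕ}
    (hE : IsSummableExponent E) (hF : IsSummableExponent F) (hG : IsSummableExponent G)
    {q : ℂ} (hq : ‖q‖ < 1) :
    ∑' v : ι × κ × μ, q ^ (E v.1 + (F v.2.1 + G v.2.2))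
      = (∑' v, q ^ E v) * ((∑' v, q ^ F v) * ∑' v, q ^ G v) := by
  rw [hF.tsum_mul hG hq]
  exact (hE.tsum_mul (hF.add hG) hq).symm

theorem tsum_pow_add_one {ι : Type*} (E : ι → ℕ) (q : ℂ) :
    ∑' v, q ^ (E v + 1) = q * ∑' v, q ^ E v := by
  rw [← tsum_mul_left]
  exact tsum_congr fun v => pow_succ' q _

theorem ncard_fiber_add {ι κ μ : Type*} {E : ι → ℕ} {F : κ → ℕ} {G : μ → ℕ}
    (hE : IsSummableExponent E) (hF : IsSummableExponent F) (hG : IsSummableExponent G)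
    (h : ∀ q : ℂ, ‖q‖ < 1 → ∑' v, q ^ E v = ∑' v, q ^ F v + ∑' v, q ^ G v) (N : ℕ) :
    {v | E v = N}.ncard = {v | F v = N}.ncard + {v | G v = N}.ncard := by
  have key := coeff_eq_of_hasSum_eq (f := fun q => ∑' v, q ^ E v)
    (a := fun N => (({v | E v = N}.ncard : ℝ) : ℂ))
    (b := fun N => (({v | F v = N}.ncard : ℝ) : ℂ) + (({v | G v = N}.ncard : ℝ) : ℂ))
    (fun q hq => hE.hasSum_ncard hq)
    (fun q hq => by
      rw [h q hq]
      simpa only [add_mul] using (hF.hasSum_ncard hq).add (hG.hasSum_ncard hq)) N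
  exact_mod_cast key

theorem norm_pow_lt_one {q : ℂ} (hq : ‖q‖ < 1) {n : ℕ} (hn : n ≠ 0) : ‖q ^ n‖ < 1 := by
  rw [norm_pow]
  exact pow_lt_one₀ (norm_nonneg q) hq hn

/-- The function equals `4 q ψ(q³) ψ(q⁶) φ(q)`, whose coefficients are counts. -/
theorem isPositiveQSeries_psi_mul_phi_sq_sub :
    IsPositiveQSeries
      (fun q => ramanujanPsi q * (ramanujanPhi q ^ 2 - ramanujanPhi (q ^ 3) ^ 2)) := by
  have hψ := isSummableExponent_two_mul_sq_add
  have hE := ((hψ.const_mul three_ne_zero).add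
    ((hψ.const_mul (n := 6) (by norm_num)).add isSummableExponent_sq)).add_one
  refine ⟨fun N => 4 * ({v : ℤ × ℤ × ℤ | 3 * (2 * v.1 ^ 2 + v.1).toNat +
    (6 * (2 * v.2.1 ^ 2 + v.2.1).toNat + v.2.2.natAbs ^ 2) + 1 = N}.ncard : ℝ),
    fun N => by positivity, fun q hq => ?_⟩
  · have h := (hE.hasSum_ncard hq).mul_left 4
    rw [tsum_pow_add_one, (hψ.const_mul three_ne_zero).tsum_mul_three
      (hψ.const_mul (n := 6) (by norm_num)) isSummableExponent_sq hq, tsum_pow_const_mul,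
      tsum_pow_const_mul, ← ramanujanPsi_eq_tsum, ← ramanujanPsi_eq_tsum,
      ← ramanujanPhi_eq_tsum] at h
    have e := (theta_identities_degree_three hq).2.1
    beta_reduce
    rw [show ramanujanPsi q * (ramanujanPhi q ^ 2 - ramanujanPhi (q ^ 3) ^ 2) =
      4 * (q * (ramanujanPsi (q ^ 3) * (ramanujanPsi (q ^ 6) * ramanujanPhi q))) by
        linear_combination e]
    refine h.congr_fun fun N => ?_
    rw [← mul_assoc]
    congr 1
    exact Complex.ofReal_mul 4 _

/-- The coefficient of `q^N` in `2 ψ(q²) φ(q)² = 2 ψ(q²) φ(q³)² + 8 q ψ(q) ψ(q³) ψ(q⁶)`. -/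
theorem ncard_odd_even_even (N : ℕ) :
    {v : ℤ × ℤ × ℤ | v.1 ^ 2 + v.1 + v.2.1 ^ 2 + v.2.2 ^ 2 = N}.ncard =
      {v : ℤ × ℤ × ℤ | v.1 ^ 2 + v.1 + 3 * v.2.1 ^ 2 + 3 * v.2.2 ^ 2 = N}.ncard +
      {v : ℤ × ℤ × ℤ | v.1 ^ 2 + v.1 + 3 * (v.2.1 ^ 2 + v.2.1) + 6 * (v.2.2 ^ 2 + v.2.2) + 2
        = 2 * N}.ncard := by
  have ht := isSummableExponent_triangular
  have hs := isSummableExponent_sq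
  have ht2 := ht.const_mul two_ne_zero
  have ht3 := ht.const_mul three_ne_zero
  have ht6 := ht.const_mul (n := 6) (by norm_num)
  have hs3 := hs.const_mul three_ne_zero
  have h := ncard_fiber_add (ht2.add (hs.add hs)) (ht2.add (hs3.add hs3))
    (ht.add (ht3.add ht6)).add_one (fun q hq => ?_) N
  · convert h using 2
    · ext ⟨u, v, w⟩
      change u ^ 2 + u + v ^ 2 + w ^ 2 = (N : ℤ) ↔
        2 * triangular u + (v.natAbs ^ 2 + w.natAbs ^ 2) = N
      rw [← Int.natCast_inj]
      push_cast
      rw [two_mul_triangular, sq_abs, sq_abs]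
      constructor <;> intro h <;> linarith
    · congr 1
      ext ⟨u, v, w⟩
      change u ^ 2 + u + 3 * v ^ 2 + 3 * w ^ 2 = (N : ℤ) ↔
        2 * triangular u + (3 * v.natAbs ^ 2 + 3 * w.natAbs ^ 2) = N
      rw [← Int.natCast_inj]
      push_cast
      rw [two_mul_triangular, sq_abs, sq_abs]
      constructor <;> intro h <;> linarith
    · congr 1
      ext ⟨u, v, w⟩
      change u ^ 2 + u + 3 * (v ^ 2 + v) + 6 * (w ^ 2 + w) + 2 = 2 * (N : ℤ) ↔
        triangular u + (3 * triangular v + 6 * triangular w) + 1 = N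
      rw [← Int.natCast_inj]
      push_cast
      rw [← two_mul_triangular, ← two_mul_triangular, ← two_mul_triangular]
      constructor <;> intro h <;> linarith
  · have e := (theta_identities_degree_three hq).1
    rw [ht2.tsum_mul_three hs hs hq, ht2.tsum_mul_three hs3 hs3 hq, tsum_pow_add_one,
      ht.tsum_mul_three ht3 ht6 hq]
    simp only [tsum_pow_const_mul]
    rw [tsum_pow_triangular hq, tsum_pow_triangular (norm_pow_lt_one hq two_ne_zero),
      tsum_pow_triangular (norm_pow_lt_one hq three_ne_zero),
      tsum_pow_triangular (norm_pow_lt_one hq (by norm_num)), tsum_pow_sq, tsum_pow_sq]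
    linear_combination 2 * e

/-- The coefficient of `q^N` in `4 φ(q) ψ(q²)² = 4 q φ(q) ψ(q⁶)² + 4 ψ(q) ψ(q³) φ(q³)`. -/
theorem ncard_odd_odd_even (N : ℕ) :
    {v : ℤ × ℤ × ℤ | v.1 ^ 2 + v.1 + (v.2.1 ^ 2 + v.2.1) + v.2.2 ^ 2 = N}.ncard =
      {v : ℤ × ℤ × ℤ | 3 * (v.1 ^ 2 + v.1) + 3 * (v.2.1 ^ 2 + v.2.1) + v.2.2 ^ 2 + 1 = N}.ncard +
      {v : ℤ × ℤ × ℤ | v.1 ^ 2 + v.1 + 3 * (v.2.1 ^ 2 + v.2.1) + 6 * v.2.2 ^ 2 = 2 * N}.ncard := by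
  have ht := isSummableExponent_triangular
  have hs := isSummableExponent_sq
  have ht2 := ht.const_mul two_ne_zero
  have ht3 := ht.const_mul three_ne_zero
  have ht6 := ht.const_mul (n := 6) (by norm_num)
  have hs3 := hs.const_mul three_ne_zero
  have h := ncard_fiber_add (ht2.add (ht2.add hs)) (ht6.add (ht6.add hs)).add_one
    (ht.add (ht3.add hs3)) (fun q hq => ?_) N
  · convert h using 2
    · ext ⟨u, v, w⟩
      change u ^ 2 + u + (v ^ 2 + v) + w ^ 2 = (N : ℤ) ↔
        2 * triangular u + (2 * triangular v + w.natAbs ^ 2) = N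
      rw [← Int.natCast_inj]
      push_cast
      rw [two_mul_triangular, two_mul_triangular, sq_abs]
      constructor <;> intro h <;> linarith
    · congr 1
      ext ⟨u, v, w⟩
      change 3 * (u ^ 2 + u) + 3 * (v ^ 2 + v) + w ^ 2 + 1 = (N : ℤ) ↔
        6 * triangular u + (6 * triangular v + w.natAbs ^ 2) + 1 = N
      rw [← Int.natCast_inj]
      push_cast
      rw [← two_mul_triangular, ← two_mul_triangular, sq_abs]
      constructor <;> intro h <;> linarith
    · congr 1
      ext ⟨u, v, w⟩
      change u ^ 2 + u + 3 * (v ^ 2 + v) + 6 * w ^ 2 = 2 * (N : ℤ) ↔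
        triangular u + (3 * triangular v + 3 * w.natAbs ^ 2) = N
      rw [← Int.natCast_inj]
      push_cast
      rw [← two_mul_triangular, ← two_mul_triangular, sq_abs]
      constructor <;> intro h <;> linarith
  · have e := (theta_identities_degree_three hq).2.2
    rw [ht2.tsum_mul_three ht2 hs hq, tsum_pow_add_one, ht6.tsum_mul_three ht6 hs hq,
      ht.tsum_mul_three ht3 hs3 hq]
    simp only [tsum_pow_const_mul]
    rw [tsum_pow_triangular hq, tsum_pow_triangular (norm_pow_lt_one hq two_ne_zero),
      tsum_pow_triangular (norm_pow_lt_one hq three_ne_zero),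
      tsum_pow_triangular (norm_pow_lt_one hq (by norm_num)), tsum_pow_sq, tsum_pow_sq]
    linear_combination 4 * e

/-! ### Representations by ternary forms -/

theorem ternaryRepCount_of_neg {a b c M : ℤ} (ha : 0 ≤ a) (hb : 0 ≤ b) (hc : 0 ≤ c) (hM : M < 0) :
    ternaryRepCount a b c 0 0 0 M = 0 := by
  unfold ternaryRepCount
  convert Set.ncard_empty (ℤ × ℤ × ℤ)
  ext ⟨x, y, z⟩
  simp only [Set.mem_ofPred_eq, Set.mem_empty_iff_false, iff_false]
  intro h
  have h1 : 0 ≤ a * x ^ 2 := by positivity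
  have h2 : 0 ≤ b * y ^ 2 := by positivity
  have h3 : 0 ≤ c * z ^ 2 := by positivity
  linarith

theorem ncard_of_image {α β : Type*} {A : Set α} {S : Set β} {f : α → β}
    (hf : Function.Injective f) (h : S = f '' A) : S.ncard = A.ncard := by
  rw [h, Set.ncard_image_of_injective A hf]

theorem ncard_of_two_images {α β : Type*} {A : Set α} {S : Set β} {f g : α → β}
    (hf : Function.Injective f) (hg : Function.Injective g) (hfg : ∀ a b, f a ≠ g b)
    (hA : A.Finite) (h : S = f '' A ∪ g '' A) : S.ncard = 2 * A.ncard := by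
  have hd : Disjoint (f '' A) (g '' A) := by
    rw [Set.disjoint_left]
    rintro _ ⟨a, -, rfl⟩ ⟨b, -, hb⟩
    exact hfg a b hb.symm
  rw [h, Set.ncard_union_eq hd (hA.image f) (hA.image g), Set.ncard_image_of_injective A hf,
    Set.ncard_image_of_injective A hg, two_mul]

theorem ncard_of_three_images {α β : Type*} {A : Set α} {S : Set β} {f g k : α → β}
    (hf : Function.Injective f) (hg : Function.Injective g) (hk : Function.Injective k)
    (hfg : ∀ a b, f a ≠ g b) (hfk : ∀ a b, f a ≠ k b) (hgk : ∀ a b, g a ≠ k b)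
    (hS : S.Finite) (h : S = f '' A ∪ g '' A ∪ k '' A) : S.ncard = 3 * A.ncard := by
  have hA : A.Finite := Set.Finite.of_finite_image
    (hS.subset (by rw [h]; exact Set.subset_union_right)) hk.injOn
  have hd : Disjoint (f '' A ∪ g '' A) (k '' A) := by
    rw [Set.disjoint_left]
    rintro _ (⟨a, -, rfl⟩ | ⟨a, -, rfl⟩) ⟨b, -, hb⟩
    · exact hfk a b hb.symm
    · exact hgk a b hb.symm
  rw [h, Set.ncard_union_eq hd ((hA.image f).union (hA.image g)) (hA.image k),
    Set.ncard_image_of_injective A hk, ncard_of_two_images hf hg hfg hA rfl]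
  ring

theorem even_sq_int (x : ℤ) : (2 * x) ^ 2 = 4 * x ^ 2 := by ring

theorem odd_sq_int (x : ℤ) : (2 * x + 1) ^ 2 = 4 * (x ^ 2 + x) + 1 := by ring

/-- Modulo `4`, exactly one of the three squares is odd. -/
theorem ternaryRepCount_one_one_one_of_one_mod_four (N : ℤ) :
    ternaryRepCount 1 1 1 0 0 0 (4 * N + 1) =
      3 * {v : ℤ × ℤ × ℤ | v.1 ^ 2 + v.1 + v.2.1 ^ 2 + v.2.2 ^ 2 = N}.ncard := by
  refine ncard_of_three_images
    (f := fun v : ℤ × ℤ × ℤ => (2 * v.1 + 1, 2 * v.2.1, 2 * v.2.2))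
    (g := fun v : ℤ × ℤ × ℤ => (2 * v.2.1, 2 * v.1 + 1, 2 * v.2.2))
    (k := fun v : ℤ × ℤ × ℤ => (2 * v.2.1, 2 * v.2.2, 2 * v.1 + 1))
    ?_ ?_ ?_ ?_ ?_ ?_ (ternaryRep_finite one_pos one_pos one_pos _) ?_
  · rintro ⟨a, b, c⟩ ⟨a', b', c'⟩ h; simp only [Prod.mk.injEq] at h ⊢; omega
  · rintro ⟨a, b, c⟩ ⟨a', b', c'⟩ h; simp only [Prod.mk.injEq] at h ⊢; omega
  · rintro ⟨a, b, c⟩ ⟨a', b', c'⟩ h; simp only [Prod.mk.injEq] at h ⊢; omega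
  · rintro ⟨a, b, c⟩ ⟨a', b', c'⟩ h; simp only [Prod.mk.injEq] at h; omega
  · rintro ⟨a, b, c⟩ ⟨a', b', c'⟩ h; simp only [Prod.mk.injEq] at h; omega
  · rintro ⟨a, b, c⟩ ⟨a', b', c'⟩ h; simp only [Prod.mk.injEq] at h; omega
  · ext ⟨x, y, z⟩
    constructor
    · intro h
      change 4 * N + 1 = 1 * x ^ 2 + 1 * y ^ 2 + 1 * z ^ 2 + 0 * y * z + 0 * z * x + 0 * x * y at h
      obtain ⟨x, rfl | rfl⟩ := Int.even_or_odd' x <;>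
        obtain ⟨y, rfl | rfl⟩ := Int.even_or_odd' y <;>
        obtain ⟨z, rfl | rfl⟩ := Int.even_or_odd' z <;>
        simp only [even_sq_int, odd_sq_int, zero_mul, add_zero, one_mul] at h
      · omega
      · exact Or.inr ⟨(z, x, y), by change z ^ 2 + z + x ^ 2 + y ^ 2 = N; omega, rfl⟩
      · exact Or.inl (Or.inr ⟨(y, x, z), by change y ^ 2 + y + x ^ 2 + z ^ 2 = N; omega, rfl⟩)
      · omega
      · exact Or.inl (Or.inl ⟨(x, y, z), by change x ^ 2 + x + y ^ 2 + z ^ 2 = N; omega, rfl⟩)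
      · omega
      · omega
      · omega
    · rintro ((⟨⟨u, v, w⟩, h, he⟩ | ⟨⟨u, v, w⟩, h, he⟩) | ⟨⟨u, v, w⟩, h, he⟩) <;>
      · change u ^ 2 + u + v ^ 2 + w ^ 2 = N at h
        simp only [Prod.mk.injEq] at he
        obtain ⟨rfl, rfl, rfl⟩ := he
        simp only [Set.mem_ofPred_eq]
        linear_combination -4 * h

/-- Modulo `4`, exactly two of the three squares are odd. -/
theorem ternaryRepCount_one_one_one_of_two_mod_four (N : ℤ) :
    ternaryRepCount 1 1 1 0 0 0 (4 * N + 2) =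
      3 * {v : ℤ × ℤ × ℤ | v.1 ^ 2 + v.1 + (v.2.1 ^ 2 + v.2.1) + v.2.2 ^ 2 = N}.ncard := by
  refine ncard_of_three_images
    (f := fun v : ℤ × ℤ × ℤ => (2 * v.1 + 1, 2 * v.2.1 + 1, 2 * v.2.2))
    (g := fun v : ℤ × ℤ × ℤ => (2 * v.1 + 1, 2 * v.2.2, 2 * v.2.1 + 1))
    (k := fun v : ℤ × ℤ × ℤ => (2 * v.2.2, 2 * v.1 + 1, 2 * v.2.1 + 1))
    ?_ ?_ ?_ ?_ ?_ ?_ (ternaryRep_finite one_pos one_pos one_pos _) ?_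
  · rintro ⟨a, b, c⟩ ⟨a', b', c'⟩ h; simp only [Prod.mk.injEq] at h ⊢; omega
  · rintro ⟨a, b, c⟩ ⟨a', b', c'⟩ h; simp only [Prod.mk.injEq] at h ⊢; omega
  · rintro ⟨a, b, c⟩ ⟨a', b', c'⟩ h; simp only [Prod.mk.injEq] at h ⊢; omega
  · rintro ⟨a, b, c⟩ ⟨a', b', c'⟩ h; simp only [Prod.mk.injEq] at h; omega
  · rintro ⟨a, b, c⟩ ⟨a', b', c'⟩ h; simp only [Prod.mk.injEq] at h; omega
  · rintro ⟨a, b, c⟩ ⟨a', b', c'⟩ h; simp only [Prod.mk.injEq] at h; omega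
  · ext ⟨x, y, z⟩
    constructor
    · intro h
      change 4 * N + 2 = 1 * x ^ 2 + 1 * y ^ 2 + 1 * z ^ 2 + 0 * y * z + 0 * z * x + 0 * x * y at h
      obtain ⟨x, rfl | rfl⟩ := Int.even_or_odd' x <;>
        obtain ⟨y, rfl | rfl⟩ := Int.even_or_odd' y <;>
        obtain ⟨z, rfl | rfl⟩ := Int.even_or_odd' z <;>
        simp only [even_sq_int, odd_sq_int, zero_mul, add_zero, one_mul] at h
      · omega
      · omega
      · omega
      · exact Or.inr ⟨(y, z, x), by change y ^ 2 + y + (z ^ 2 + z) + x ^ 2 = N; omega, rfl⟩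
      · omega
      · exact Or.inl (Or.inr ⟨(x, z, y), by change x ^ 2 + x + (z ^ 2 + z) + y ^ 2 = N; omega, rfl⟩)
      · exact Or.inl (Or.inl ⟨(x, y, z), by change x ^ 2 + x + (y ^ 2 + y) + z ^ 2 = N; omega, rfl⟩)
      · omega
    · rintro ((⟨⟨u, v, w⟩, h, he⟩ | ⟨⟨u, v, w⟩, h, he⟩) | ⟨⟨u, v, w⟩, h, he⟩) <;>
      · change u ^ 2 + u + (v ^ 2 + v) + w ^ 2 = N at h
        simp only [Prod.mk.injEq] at he
        obtain ⟨rfl, rfl, rfl⟩ := he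
        simp only [Set.mem_ofPred_eq]
        linear_combination -4 * h

theorem exists_sum_diff_of_even {y z : ℤ} (h : (y + z) % 2 = 0) :
    ∃ s t : ℤ, y = s + t ∧ z = s - t :=
  ⟨(y + z) / 2, (y - z) / 2, by omega, by omega⟩

/-- Modulo `4`, the last two variables `y`, `z` have equal parity; `y = s + t` and `z = s - t`. -/
theorem ternaryRepCount_one_six_six_of_one_mod_four (N : ℤ) :
    ternaryRepCount 1 6 6 0 0 0 (4 * N + 1) =
      {v : ℤ × ℤ × ℤ | v.1 ^ 2 + v.1 + 3 * v.2.1 ^ 2 + 3 * v.2.2 ^ 2 = N}.ncard := by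
  refine ncard_of_image
    (f := fun v : ℤ × ℤ × ℤ => (2 * v.1 + 1, v.2.1 + v.2.2, v.2.1 - v.2.2)) ?_ ?_
  · rintro ⟨a, b, c⟩ ⟨a', b', c'⟩ h; simp only [Prod.mk.injEq] at h ⊢; omega
  · ext ⟨x, y, z⟩
    constructor
    · intro h
      change 4 * N + 1 = 1 * x ^ 2 + 6 * y ^ 2 + 6 * z ^ 2 + 0 * y * z + 0 * z * x + 0 * x * y at h
      have hp : (y + z) % 2 = 0 := by
        obtain ⟨x, rfl | rfl⟩ := Int.even_or_odd' x <;>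
          obtain ⟨y, rfl | rfl⟩ := Int.even_or_odd' y <;>
          obtain ⟨z, rfl | rfl⟩ := Int.even_or_odd' z <;>
          simp only [even_sq_int, odd_sq_int, zero_mul, add_zero, one_mul] at h <;> omega
      obtain ⟨s, t, rfl, rfl⟩ := exists_sum_diff_of_even hp
      obtain ⟨u, rfl | rfl⟩ := Int.even_or_odd' x
      · ring_nf at h; omega
      · refine ⟨(u, s, t), ?_, rfl⟩
        change u ^ 2 + u + 3 * s ^ 2 + 3 * t ^ 2 = N
        linarith
    · rintro ⟨⟨u, s, t⟩, h, he⟩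
      change u ^ 2 + u + 3 * s ^ 2 + 3 * t ^ 2 = N at h
      simp only [Prod.mk.injEq] at he
      obtain ⟨rfl, rfl, rfl⟩ := he
      simp only [Set.mem_ofPred_eq]
      linear_combination -4 * h

/-- Modulo `4`, the last two variables `y`, `z` have different parity; `y = s + t + 1` and
`z = s - t`. -/
theorem ternaryRepCount_one_six_six_of_two_mod_four (N : ℤ) :
    ternaryRepCount 1 6 6 0 0 0 (4 * N + 2) =
      {v : ℤ × ℤ × ℤ | 3 * (v.1 ^ 2 + v.1) + 3 * (v.2.1 ^ 2 + v.2.1) + v.2.2 ^ 2 + 1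
        = N}.ncard := by
  refine ncard_of_image
    (f := fun v : ℤ × ℤ × ℤ => (2 * v.2.2, v.1 + v.2.1 + 1, v.1 - v.2.1)) ?_ ?_
  · rintro ⟨a, b, c⟩ ⟨a', b', c'⟩ h; simp only [Prod.mk.injEq] at h ⊢; omega
  · ext ⟨x, y, z⟩
    constructor
    · intro h
      change 4 * N + 2 = 1 * x ^ 2 + 6 * y ^ 2 + 6 * z ^ 2 + 0 * y * z + 0 * z * x + 0 * x * y at h
      have hp : (y - 1 + z) % 2 = 0 := by
        obtain ⟨x, rfl | rfl⟩ := Int.even_or_odd' x <;>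
          obtain ⟨y, rfl | rfl⟩ := Int.even_or_odd' y <;>
          obtain ⟨z, rfl | rfl⟩ := Int.even_or_odd' z <;>
          simp only [even_sq_int, odd_sq_int, zero_mul, add_zero, one_mul] at h <;> omega
      obtain ⟨s, t, hy, rfl⟩ := exists_sum_diff_of_even hp
      obtain rfl : y = s + t + 1 := by omega
      obtain ⟨u, rfl | rfl⟩ := Int.even_or_odd' x
      · refine ⟨(s, t, u), ?_, rfl⟩
        change 3 * (s ^ 2 + s) + 3 * (t ^ 2 + t) + u ^ 2 + 1 = N
        linarith
      · ring_nf at h; omega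
    · rintro ⟨⟨s, t, u⟩, h, he⟩
      change 3 * (s ^ 2 + s) + 3 * (t ^ 2 + t) + u ^ 2 + 1 = N at h
      simp only [Prod.mk.injEq] at he
      obtain ⟨rfl, rfl, rfl⟩ := he
      simp only [Set.mem_ofPred_eq]
      linear_combination -4 * h

/-- The Eisenstein rotation in coordinates: the triples counted on the right, with the first two
entries of equal parity, are `(s + t, s - t, u)`, and correspond to `(2 s - t + 1, 2 u + 1, -t)`;
those of different parity are obtained from them by the reflection `n ↦ -1 - n`. -/
theorem two_mul_ternaryRepCount_two_three_six_of_one_mod_four (N : ℤ) :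
    {v : ℤ × ℤ × ℤ | v.1 ^ 2 + v.1 + 3 * (v.2.1 ^ 2 + v.2.1) + 6 * (v.2.2 ^ 2 + v.2.2) + 2
        = 2 * N}.ncard = 2 * ternaryRepCount 2 3 6 0 0 0 (4 * N + 1) := by
  let A : Set (ℤ × ℤ × ℤ) := {v | 4 * (v.1 ^ 2 - v.1 * v.2.1 + v.2.1 ^ 2) + 4 * v.1 - 2 * v.2.1
    + 6 * (v.2.2 ^ 2 + v.2.2) + 2 = 2 * N}
  have hinj : Function.Injective
      (fun v : ℤ × ℤ × ℤ => (2 * v.1 - v.2.1 + 1, 2 * v.2.2 + 1, -v.2.1)) := by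
    rintro ⟨a, b, c⟩ ⟨a', b', c'⟩ h; simp only [Prod.mk.injEq] at h ⊢; omega
  have himg : {v : ℤ × ℤ × ℤ | 4 * N + 1 = 2 * v.1 ^ 2 + 3 * v.2.1 ^ 2 + 6 * v.2.2 ^ 2
      + 0 * v.2.1 * v.2.2 + 0 * v.2.2 * v.1 + 0 * v.1 * v.2.1}
      = (fun v : ℤ × ℤ × ℤ => (2 * v.1 - v.2.1 + 1, 2 * v.2.2 + 1, -v.2.1)) '' A := by
    ext ⟨x, y, z⟩
    constructor
    · intro h
      change 4 * N + 1 = 2 * x ^ 2 + 3 * y ^ 2 + 6 * z ^ 2 + 0 * y * z + 0 * z * x + 0 * x * y at h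
      have hp : (x + z) % 2 = 1 ∧ y % 2 = 1 := by
        obtain ⟨x, rfl | rfl⟩ := Int.even_or_odd' x <;>
          obtain ⟨y, rfl | rfl⟩ := Int.even_or_odd' y <;>
          obtain ⟨z, rfl | rfl⟩ := Int.even_or_odd' z <;>
          simp only [even_sq_int, odd_sq_int, zero_mul, add_zero] at h <;> omega
      obtain ⟨t, rfl⟩ : ∃ t, z = -t := ⟨-z, by ring⟩
      obtain ⟨s, rfl⟩ : ∃ s, x = 2 * s - t + 1 := ⟨(x + t - 1) / 2, by omega⟩
      obtain ⟨u, rfl⟩ : ∃ u, y = 2 * u + 1 := ⟨y / 2, by omega⟩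
      refine ⟨(s, t, u), ?_, rfl⟩
      change 4 * (s ^ 2 - s * t + t ^ 2) + 4 * s - 2 * t + 6 * (u ^ 2 + u) + 2 = 2 * N
      linarith
    · rintro ⟨⟨s, t, u⟩, h, he⟩
      change 4 * (s ^ 2 - s * t + t ^ 2) + 4 * s - 2 * t + 6 * (u ^ 2 + u) + 2 = 2 * N at h
      simp only [Prod.mk.injEq] at he
      obtain ⟨rfl, rfl, rfl⟩ := he
      simp only [Set.mem_ofPred_eq]
      linear_combination -2 * h
  have hA : A.Finite := Set.Finite.of_finite_image
    (himg ▸ ternaryRep_finite two_pos three_pos (by norm_num) _) hinj.injOn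
  rw [show ternaryRepCount 2 3 6 0 0 0 (4 * N + 1) = A.ncard from ncard_of_image hinj himg]
  refine ncard_of_two_images (f := fun v : ℤ × ℤ × ℤ => (v.1 + v.2.1, v.1 - v.2.1, v.2.2))
    (g := fun v : ℤ × ℤ × ℤ => (-1 - (v.1 + v.2.1), v.1 - v.2.1, v.2.2)) ?_ ?_ ?_ hA ?_
  · rintro ⟨a, b, c⟩ ⟨a', b', c'⟩ h; simp only [Prod.mk.injEq] at h ⊢; omega
  · rintro ⟨a, b, c⟩ ⟨a', b', c'⟩ h; simp only [Prod.mk.injEq] at h ⊢; omega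
  · rintro ⟨a, b, c⟩ ⟨a', b', c'⟩ h; simp only [Prod.mk.injEq] at h; omega
  · ext ⟨n, m, u⟩
    constructor
    · intro h
      change n ^ 2 + n + 3 * (m ^ 2 + m) + 6 * (u ^ 2 + u) + 2 = 2 * N at h
      rcases (by omega : (n + m) % 2 = 0 ∨ (-1 - n + m) % 2 = 0) with hp | hp
      · obtain ⟨s, t, rfl, rfl⟩ := exists_sum_diff_of_even hp
        refine Or.inl ⟨(s, t, u), ?_, rfl⟩
        change 4 * (s ^ 2 - s * t + t ^ 2) + 4 * s - 2 * t + 6 * (u ^ 2 + u) + 2 = 2 * N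
        linarith
      · obtain ⟨s, t, hn, rfl⟩ := exists_sum_diff_of_even hp
        obtain rfl : n = -1 - (s + t) := by omega
        refine Or.inr ⟨(s, t, u), ?_, rfl⟩
        change 4 * (s ^ 2 - s * t + t ^ 2) + 4 * s - 2 * t + 6 * (u ^ 2 + u) + 2 = 2 * N
        linarith
    · rintro (⟨⟨s, t, u⟩, h, he⟩ | ⟨⟨s, t, u⟩, h, he⟩) <;>
      · change 4 * (s ^ 2 - s * t + t ^ 2) + 4 * s - 2 * t + 6 * (u ^ 2 + u) + 2 = 2 * N at h
        simp only [Prod.mk.injEq] at he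
        obtain ⟨rfl, rfl, rfl⟩ := he
        simp only [Set.mem_ofPred_eq]
        linear_combination h

/-- The correspondence is that of `two_mul_ternaryRepCount_two_three_six_of_one_mod_four`, with an
even middle variable: `(s + t, s - t, u)` corresponds to `(2 s - t + 1, 2 u, -t)`. -/
theorem two_mul_ternaryRepCount_two_three_six_of_two_mod_four (N : ℤ) :
    {v : ℤ × ℤ × ℤ | v.1 ^ 2 + v.1 + 3 * (v.2.1 ^ 2 + v.2.1) + 6 * v.2.2 ^ 2 = 2 * N}.ncard =
      2 * ternaryRepCount 2 3 6 0 0 0 (4 * N + 2) := by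
  let A : Set (ℤ × ℤ × ℤ) := {v | 4 * (v.1 ^ 2 - v.1 * v.2.1 + v.2.1 ^ 2) + 4 * v.1 - 2 * v.2.1
    + 6 * v.2.2 ^ 2 = 2 * N}
  have hinj : Function.Injective
      (fun v : ℤ × ℤ × ℤ => (2 * v.1 - v.2.1 + 1, 2 * v.2.2, -v.2.1)) := by
    rintro ⟨a, b, c⟩ ⟨a', b', c'⟩ h; simp only [Prod.mk.injEq] at h ⊢; omega
  have himg : {v : ℤ × ℤ × ℤ | 4 * N + 2 = 2 * v.1 ^ 2 + 3 * v.2.1 ^ 2 + 6 * v.2.2 ^ 2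
      + 0 * v.2.1 * v.2.2 + 0 * v.2.2 * v.1 + 0 * v.1 * v.2.1}
      = (fun v : ℤ × ℤ × ℤ => (2 * v.1 - v.2.1 + 1, 2 * v.2.2, -v.2.1)) '' A := by
    ext ⟨x, y, z⟩
    constructor
    · intro h
      change 4 * N + 2 = 2 * x ^ 2 + 3 * y ^ 2 + 6 * z ^ 2 + 0 * y * z + 0 * z * x + 0 * x * y at h
      have hp : (x + z) % 2 = 1 ∧ y % 2 = 0 := by
        obtain ⟨x, rfl | rfl⟩ := Int.even_or_odd' x <;>
          obtain ⟨y, rfl | rfl⟩ := Int.even_or_odd' y <;>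
          obtain ⟨z, rfl | rfl⟩ := Int.even_or_odd' z <;>
          simp only [even_sq_int, odd_sq_int, zero_mul, add_zero] at h <;> omega
      obtain ⟨t, rfl⟩ : ∃ t, z = -t := ⟨-z, by ring⟩
      obtain ⟨s, rfl⟩ : ∃ s, x = 2 * s - t + 1 := ⟨(x + t - 1) / 2, by omega⟩
      obtain ⟨u, rfl⟩ : ∃ u, y = 2 * u := ⟨y / 2, by omega⟩
      refine ⟨(s, t, u), ?_, rfl⟩
      change 4 * (s ^ 2 - s * t + t ^ 2) + 4 * s - 2 * t + 6 * u ^ 2 = 2 * N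
      linarith
    · rintro ⟨⟨s, t, u⟩, h, he⟩
      change 4 * (s ^ 2 - s * t + t ^ 2) + 4 * s - 2 * t + 6 * u ^ 2 = 2 * N at h
      simp only [Prod.mk.injEq] at he
      obtain ⟨rfl, rfl, rfl⟩ := he
      simp only [Set.mem_ofPred_eq]
      linear_combination -2 * h
  have hA : A.Finite := Set.Finite.of_finite_image
    (himg ▸ ternaryRep_finite two_pos three_pos (by norm_num) _) hinj.injOn
  rw [show ternaryRepCount 2 3 6 0 0 0 (4 * N + 2) = A.ncard from ncard_of_image hinj himg]
  refine ncard_of_two_images (f := fun v : ℤ × ℤ × ℤ => (v.1 + v.2.1, v.1 - v.2.1, v.2.2))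
    (g := fun v : ℤ × ℤ × ℤ => (-1 - (v.1 + v.2.1), v.1 - v.2.1, v.2.2)) ?_ ?_ ?_ hA ?_
  · rintro ⟨a, b, c⟩ ⟨a', b', c'⟩ h; simp only [Prod.mk.injEq] at h ⊢; omega
  · rintro ⟨a, b, c⟩ ⟨a', b', c'⟩ h; simp only [Prod.mk.injEq] at h ⊢; omega
  · rintro ⟨a, b, c⟩ ⟨a', b', c'⟩ h; simp only [Prod.mk.injEq] at h; omega
  · ext ⟨n, m, u⟩
    constructor
    · intro h
      change n ^ 2 + n + 3 * (m ^ 2 + m) + 6 * u ^ 2 = 2 * N at h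
      rcases (by omega : (n + m) % 2 = 0 ∨ (-1 - n + m) % 2 = 0) with hp | hp
      · obtain ⟨s, t, rfl, rfl⟩ := exists_sum_diff_of_even hp
        refine Or.inl ⟨(s, t, u), ?_, rfl⟩
        change 4 * (s ^ 2 - s * t + t ^ 2) + 4 * s - 2 * t + 6 * u ^ 2 = 2 * N
        linarith
      · obtain ⟨s, t, hn, rfl⟩ := exists_sum_diff_of_even hp
        obtain rfl : n = -1 - (s + t) := by omega
        refine Or.inr ⟨(s, t, u), ?_, rfl⟩
        change 4 * (s ^ 2 - s * t + t ^ 2) + 4 * s - 2 * t + 6 * u ^ 2 = 2 * N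
        linarith
    · rintro (⟨⟨s, t, u⟩, h, he⟩ | ⟨⟨s, t, u⟩, h, he⟩) <;>
      · change 4 * (s ^ 2 - s * t + t ^ 2) + 4 * s - 2 * t + 6 * u ^ 2 = 2 * N at h
        simp only [Prod.mk.injEq] at he
        obtain ⟨rfl, rfl, rfl⟩ := he
        simp only [Set.mem_ofPred_eq]
        linear_combination h

/-- Both sides count the triples with `u² + u + 2 s² + 2 t² = 2 N`: on the right, the last
two coordinates have equal parity, and `s`, `t` are half their sum and half their difference. -/
theorem ternaryRepCount_one_eight_eight (N : ℤ) :
    ternaryRepCount 1 8 8 0 0 0 (4 * (2 * N) + 1) =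
      {v : ℤ × ℤ × ℤ | v.1 ^ 2 + v.1 + v.2.1 ^ 2 + v.2.2 ^ 2 = 2 * N}.ncard := by
  let A : Set (ℤ × ℤ × ℤ) := {v | v.1 ^ 2 + v.1 + 2 * v.2.1 ^ 2 + 2 * v.2.2 ^ 2 = 2 * N}
  have h1 : ternaryRepCount 1 8 8 0 0 0 (4 * (2 * N) + 1) = A.ncard := by
    refine ncard_of_image (f := fun v : ℤ × ℤ × ℤ => (2 * v.1 + 1, v.2.1, v.2.2)) ?_ ?_
    · rintro ⟨a, b, c⟩ ⟨a', b', c'⟩ h; simp only [Prod.mk.injEq] at h ⊢; omega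
    · ext ⟨x, y, z⟩
      constructor
      · intro h
        change 4 * (2 * N) + 1 =
          1 * x ^ 2 + 8 * y ^ 2 + 8 * z ^ 2 + 0 * y * z + 0 * z * x + 0 * x * y at h
        obtain ⟨u, rfl | rfl⟩ := Int.even_or_odd' x
        · ring_nf at h; omega
        · refine ⟨(u, y, z), ?_, rfl⟩
          change u ^ 2 + u + 2 * y ^ 2 + 2 * z ^ 2 = 2 * N
          linarith
      · rintro ⟨⟨u, s, t⟩, h, he⟩
        change u ^ 2 + u + 2 * s ^ 2 + 2 * t ^ 2 = 2 * N at h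
        simp only [Prod.mk.injEq] at he
        obtain ⟨rfl, rfl, rfl⟩ := he
        simp only [Set.mem_ofPred_eq]
        linear_combination -4 * h
  rw [h1]
  refine (ncard_of_image (f := fun v : ℤ × ℤ × ℤ => (v.1, v.2.1 + v.2.2, v.2.1 - v.2.2))
    ?_ ?_).symm
  · rintro ⟨a, b, c⟩ ⟨a', b', c'⟩ h; simp only [Prod.mk.injEq] at h ⊢; omega
  · ext ⟨u, y, z⟩
    constructor
    · intro h
      change u ^ 2 + u + y ^ 2 + z ^ 2 = 2 * N at h
      have hu := two_mul_triangular u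
      have hp : (y + z) % 2 = 0 := by
        obtain ⟨y, rfl | rfl⟩ := Int.even_or_odd' y <;>
          obtain ⟨z, rfl | rfl⟩ := Int.even_or_odd' z <;>
          simp only [even_sq_int, odd_sq_int] at h <;> omega
      obtain ⟨s, t, rfl, rfl⟩ := exists_sum_diff_of_even hp
      refine ⟨(u, s, t), ?_, rfl⟩
      change u ^ 2 + u + 2 * s ^ 2 + 2 * t ^ 2 = 2 * N
      linarith
    · rintro ⟨⟨u, s, t⟩, h, he⟩
      change u ^ 2 + u + 2 * s ^ 2 + 2 * t ^ 2 = 2 * N at h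
      simp only [Prod.mk.injEq] at he
      obtain ⟨rfl, rfl, rfl⟩ := he
      simp only [Set.mem_ofPred_eq]
      linear_combination h

theorem ternary_identity_of_one_mod_four (N : ℤ) :
    ternaryRepCount 1 1 1 0 0 0 (4 * N + 1) =
      3 * (ternaryRepCount 1 6 6 0 0 0 (4 * N + 1) +
        2 * ternaryRepCount 2 3 6 0 0 0 (4 * N + 1)) := by
  rcases lt_or_ge N 0 with h | h
  · rw [ternaryRepCount_of_neg, ternaryRepCount_of_neg, ternaryRepCount_of_neg] <;> omega
  · lift N to ℕ using h
    rw [ternaryRepCount_one_one_one_of_one_mod_four, ternaryRepCount_one_six_six_of_one_mod_four,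
      ← two_mul_ternaryRepCount_two_three_six_of_one_mod_four, ncard_odd_even_even]

theorem ternary_identity_of_two_mod_four (N : ℤ) :
    ternaryRepCount 1 1 1 0 0 0 (4 * N + 2) =
      3 * (ternaryRepCount 1 6 6 0 0 0 (4 * N + 2) +
        2 * ternaryRepCount 2 3 6 0 0 0 (4 * N + 2)) := by
  rcases lt_or_ge N 0 with h | h
  · rw [ternaryRepCount_of_neg, ternaryRepCount_of_neg, ternaryRepCount_of_neg] <;> omega
  · lift N to ℕ using h
    rw [ternaryRepCount_one_one_one_of_two_mod_four, ternaryRepCount_one_six_six_of_two_mod_four,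
      ← two_mul_ternaryRepCount_two_three_six_of_two_mod_four, ncard_odd_odd_even]

theorem ternary_identity {M : ℤ} (hM : M ≡ 1 [ZMOD 4] ∨ M ≡ 2 [ZMOD 4]) :
    (1 / 3 : ℚ) * ternaryRepCount 1 1 1 0 0 0 M =
      ternaryRepCount 1 6 6 0 0 0 M + 2 * ternaryRepCount 2 3 6 0 0 0 M := by
  rcases hM with h | h
  · obtain ⟨N, rfl⟩ : ∃ N, M = 4 * N + 1 := ⟨M / 4, by rw [Int.ModEq] at h; omega⟩
    rw [ternary_identity_of_one_mod_four]
    push_cast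
    ring
  · obtain ⟨N, rfl⟩ : ∃ N, M = 4 * N + 2 := ⟨M / 4, by rw [Int.ModEq] at h; omega⟩
    rw [ternary_identity_of_two_mod_four]
    push_cast
    ring

theorem ternaryRepCount_one_eight_eight_eq {M : ℤ} (hM : M ≡ 1 [ZMOD 8]) :
    (1 / 3 : ℚ) * ternaryRepCount 1 1 1 0 0 0 M = ternaryRepCount 1 8 8 0 0 0 M := by
  obtain ⟨N, rfl⟩ : ∃ N, M = 4 * (2 * N) + 1 := ⟨M / 8, by rw [Int.ModEq] at hM; omega⟩
  rw [ternaryRepCount_one_eight_eight, ternaryRepCount_one_one_one_of_one_mod_four]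
  push_cast
  ring

theorem mainTheorem6 :
    -- the ternary identity for `M ≡ 1, 2 (mod 4)`
    (∀ M : ℤ, M ≡ 1 [ZMOD 4] ∨ M ≡ 2 [ZMOD 4] →
      (1 / 3 : ℚ) * ternaryRepCount 1 1 1 0 0 0 M =
        ternaryRepCount 1 6 6 0 0 0 M + 2 * ternaryRepCount 2 3 6 0 0 0 M) ∧
    -- the ternary identities for `M ≡ 1 (mod 8)`
    (∀ M : ℤ, M ≡ 1 [ZMOD 8] →
      ternaryRepCount 1 8 8 0 0 0 M =
          ternaryRepCount 1 6 6 0 0 0 M + 2 * ternaryRepCount 2 3 6 0 0 0 M ∧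
        (1 / 3 : ℚ) * ternaryRepCount 1 1 1 0 0 0 M =
          ternaryRepCount 1 6 6 0 0 0 M + 2 * ternaryRepCount 2 3 6 0 0 0 M) ∧
    -- the three theta function identities
    (∀ q : ℂ, ‖q‖ < 1 →
      ramanujanPsi (q ^ 2) * ramanujanPhi q ^ 2 =
          ramanujanPsi (q ^ 2) * ramanujanPhi (q ^ 3) ^ 2 +
            4 * q * ramanujanPsi q * ramanujanPsi (q ^ 3) * ramanujanPsi (q ^ 6) ∧
        ramanujanPsi q * ramanujanPhi q ^ 2 =
          ramanujanPsi q * ramanujanPhi (q ^ 3) ^ 2 +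
            4 * q * ramanujanPsi (q ^ 3) * ramanujanPsi (q ^ 6) * ramanujanPhi q ∧
        ramanujanPhi q * ramanujanPsi (q ^ 2) ^ 2 =
          ramanujanPsi q * ramanujanPsi (q ^ 3) * ramanujanPhi (q ^ 3) +
            q * ramanujanPhi q * ramanujanPsi (q ^ 6) ^ 2) ∧
    -- the two modular equations of degree 3
    (∀ q : ℝ, 0 < q → q < 1 →
      ramanujanMultiplier 3 q - 1 =
          2 * (ramanujanBeta 3 q ^ (3 / 8 : ℝ) / ramanujanAlpha q ^ (1 / 8 : ℝ)) ∧
        ramanujanMultiplier 3 q =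
          ramanujanBeta 3 q ^ (1 / 2 : ℝ) / ramanujanAlpha q ^ (1 / 2 : ℝ) +
            2 * (ramanujanBeta 3 q ^ (1 / 8 : ℝ) / ramanujanAlpha q ^ (3 / 8 : ℝ))) ∧
    -- Ramanujan's parametrization
    (∀ q p : ℝ, 0 < q → q < 1 → 0 < p →
      ramanujanAlpha q = p * (2 + p) ^ 3 / (1 + 2 * p) ^ 3 →
        ramanujanBeta 3 q = p ^ 3 * (2 + p) / (1 + 2 * p) ∧
          ramanujanMultiplier 3 q = 1 + 2 * p) ∧
    -- positivity
    IsPositiveQSeries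
      (fun q => ramanujanPsi q * (ramanujanPhi q ^ 2 - ramanujanPhi (q ^ 3) ^ 2)) := by
  refine ⟨fun M hM => ternary_identity hM, fun M hM => ?_,
    fun q hq => theta_identities_degree_three hq,
    fun q h0 h1 => modular_equations_degree_three h0 h1,
    fun q p h0 h1 hp h => parametrization_degree_three h0 h1 hp h,
    isPositiveQSeries_psi_mul_phi_sq_sub⟩
  have h4 : M ≡ 1 [ZMOD 4] := hM.of_dvd (by norm_num)
  have h := ternary_identity (Or.inl h4)
  exact ⟨by exact_mod_cast (ternaryRepCount_one_eight_eight_eq hM).symm.trans h, h⟩
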